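/- Let $\mathfrak g$ be a finite-dimensional complex reductive Lie algebra with an involutive automorphism $\theta$, let $\mathfrak k=\mathfrak g^{\theta}$ and $\mathfrak p=\mathfrak g^{-\theta}$, and let $\beta$ be a nondegenerate symmetric bilinear form on $\mathfrak g$ that is invariant under $\mathfrak g$ and $\theta$. (For example, $\mathfrak g$ is the complexified Lie algebra of a connected real reductive group, $\theta$ is the Cartan involution, and $\beta$ is an invariant form that is negative definite on the real form of $\mathfrak k$, positive definite on that of $\mathfrak p$, and for which $\mathfrak k\perp\mathfrak p$.) Let $R$ be a principal ideal domain that is a $\mathbb C$-algebra, let $0\ne r\in R$, and let $1\otimes\beta$ be the $R$-bilinear extension of $\beta$ to $R\otimes_{\mathbb C}\mathfrak g$. Put $$\boldsymbol{\mathfrak k}=R\otimes_{\mathbb C}\mathfrak k,\qquad \boldsymbol{\mathfrak p}=\langle r\rangle\otimes_{\mathbb C}\mathfrak p,\qquad \boldsymbol{\mathfrak g}=\boldsymbol{\mathfrak k}\oplus\boldsymbol{\mathfrak p}\subseteq R\otimes_{\mathbb C}\mathfrak g .$$ Let $\beta^r$ be the unique $R$-bilinear form on $\boldsymbol{\mathfrak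 p}$ with $(1\otimes\beta)(x,y)=r^2\beta^r(x,y)$ for all $x,y\in\boldsymbol{\mathfrak p}$; it is symmetric and unimodular. For a unimodular symmetric form $b$ on a finitely generated projective $R$-module $\boldsymbol{\mathfrak l}$, let $\omega(\boldsymbol{\mathfrak l},b)\in\boldsymbol{\mathfrak l}\otimes_R\boldsymbol{\mathfrak l}$ be the image of the identity under $\mathrm{End}_R(\boldsymbol{\mathfrak l})\cong\boldsymbol{\mathfrak l}^*\otimes_R\boldsymbol{\mathfrak l}\cong\boldsymbol{\mathfrak l}\otimes_R\boldsymbol{\mathfrak l}$, and, if $\boldsymbol{\mathfrak l}$ is a submodule of a Lie algebra, let $\Omega(\boldsymbol{\mathfrak l},b)$ be its image in the universal enveloping algebra of that Lie algebra (and likewise over $\mathbb C$). Let $Cl(\boldsymbol{\mathfrak p},\beta^r)$ be the Clifford algebra with relations $xy+yx=\beta^r(x,y)$, let $\gamma:\boldsymbol{\mathfrak p}\to Cl(\boldsymbol{\mathfrak p},\beta^r)$ be the canonical map, and put $A=A(\boldsymbol{\mathfrak g},\beta,r)=\mathcal U(\boldsymbol{\mathfrak g})\otimes_R Cl(\boldsymbol{\mathfrak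 p},\beta^r)$. The Dirac operator $D=D(\boldsymbol{\mathfrak g},\beta,r)$ is the image of $\omega(\boldsymbol{\mathfrak p},\beta^r)$ under $\boldsymbol{\mathfrak p}\otimes_R\boldsymbol{\mathfrak p}\to A$, $x\otimes y\mapsto x\otimes\gamma(y)$. Let $\alpha:\boldsymbol{\mathfrak k}\to Cl(\boldsymbol{\mathfrak p},\beta^r)$ be the composition of $\mathrm{ad}:\boldsymbol{\mathfrak k}\to\mathfrak{so}(\boldsymbol{\mathfrak p},\beta^r)$ with the Lie algebra morphism that sends $v\mapsto\beta^r(b,v)a-\beta^r(a,v)b$ to $\tfrac12[\gamma(a),\gamma(b)]$, and let $\Delta:\mathcal U(\boldsymbol{\mathfrak k})\to A$ be the algebra morphism with $\Delta(x)=x\otimes1+1\otimes\alpha(x)$ for $x\in\boldsymbol{\mathfrak k}$. Let $$\Omega(\boldsymbol{\mathfrak g},\beta,r)=r^2\,\Omega(\boldsymbol{\mathfrak k},1\otimes\beta_{\mathfrak k})+\Omega(\boldsymbol{\mathfrak p},\beta^r)\in\mathcal U(\boldsymbol{\mathfrak g}).$$ Let $\mathfrak h$ and $\mathfrak t$ be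 Cartan subalgebras of $\mathfrak g$ and $\mathfrak k$, and let $\rho\in\mathfrak h^*$ and $\rho_{\mathfrak k}\in\mathfrak t^*$ be the half sums of the roots in any positive systems for $(\mathfrak g,\mathfrak h)$ and $(\mathfrak k,\mathfrak t)$. **Theorem (the square of the Dirac operator).** The canonical map $\mathcal U(\boldsymbol{\mathfrak g})\to R\otimes_{\mathbb C}\mathcal U(\mathfrak g)=\mathcal U(R\otimes_{\mathbb C}\mathfrak g)$ sends $\Omega(\boldsymbol{\mathfrak g},\beta,r)$ to $r^2\otimes\Omega(\mathfrak g,\beta)$. The restrictions of $\beta$ to $\mathfrak h$ and to $\mathfrak t$ are nondegenerate, and, with $\|\rho\|^2$ and $\|\rho_{\mathfrak k}\|^2$ the values at $\rho$ and $\rho_{\mathfrak k}$ of the induced forms on $\mathfrak h^*$ and $\mathfrak t^*$, in $A(\boldsymbol{\mathfrak g},\beta,r)$ $$2D^2=\Omega(\boldsymbol{\mathfrak g},\beta,r)\otimes1-r^2\,\Delta\bigl(\Omega(\boldsymbol{\mathfrak k},1\otimes\beta_{\mathfrak k})\bigr)+r^2\bigl(\|\rho\|^2-\|\rho_{\mathfrak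 k}\|^2\bigr)\cdot1 .$$ -/

import Mathlib

open scoped TensorProduct
open LinearMap (BilinForm)

noncomputable section

namespace DiracFamily

section Generic

attribute [local instance 2000] LieRing.ofAssociativeRing

variable {S : Type*} [CommRing S] {M : Type*} [AddCommGroup M] [Module S M]

/-- A bilinear form on `M` is unimodular if `x ↦ B(x, ·)` is an isomorphism from `M` onto its
dual module. -/
def Unimodular (B : BilinForm S M) : Prop :=
  Function.Bijective (B : M →ₗ[S] Module.Dual S M)

/-- The isomorphism `x ↦ B(x, ·)` of a unimodular form. -/
def Unimodular.toDual {B : BilinForm S M} (hB : Unimodular B) : M ≃ₗ[S] Module.Dual S M :=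
  LinearEquiv.ofBijective B hB

/-- The pull-back of a bilinear form along a linear map. -/
def pullForm {N : Type*} [AddCommGroup N] [Module S N] (B : BilinForm S M) (j : N →ₗ[S] M) :
    BilinForm S N :=
  B.compl₁₂ j j

/-- For linear maps `i, j` from `M` to an algebra, the linear map `x ⊗ y ↦ i x * j y`. -/
def mulMap {A : Type*} [Ring A] [Algebra S A] (i j : M →ₗ[S] A) : M ⊗[S] M →ₗ[S] A :=
  LinearMap.mul' S A ∘ₗ TensorProduct.map i j

@[simp] lemma mulMap_tmul {A : Type*} [Ring A] [Algebra S A] (i j : M →ₗ[S] A) (x y : M) :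
    mulMap i j (x ⊗ₜ y) = i x * j y := rfl

section Canonical

variable [Module.Finite S M] [Module.Projective S M] {B : BilinForm S M}

/-- The isomorphism `M ⊗ M ≃ M* ⊗ M ≃ End(M)` given by a unimodular form. -/
def Unimodular.tensorEquivEnd (hB : Unimodular B) : M ⊗[S] M ≃ₗ[S] (M →ₗ[S] M) :=
  (TensorProduct.congr hB.toDual (LinearEquiv.refl S M)).trans (dualTensorHomEquiv S M M)

lemma Unimodular.tensorEquivEnd_tmul (hB : Unimodular B) (x y b : M) :
    hB.tensorEquivEnd (x ⊗ₜ y) b = B x b • y := rfl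

/-- The canonical element `ω(M, B) ∈ M ⊗ M` of a unimodular form: the image of the identity
under `End(M) ≃ M* ⊗ M ≃ M ⊗ M`. -/
def Unimodular.canonicalElement (hB : Unimodular B) : M ⊗[S] M :=
  hB.tensorEquivEnd.symm LinearMap.id

/-- For a Lie algebra `L` and a linear map `i` from a quadratic space `(M, B)` to `L` (in practice
the inclusion of a submodule), the element `Ω(M, B)` of the enveloping algebra of `L`, the
image of `ω(M, B)` under `M ⊗ M → L ⊗ L → U(L)`. -/
def Unimodular.casimir (hB : Unimodular B) {L : Type*} [LieRing L] [LieAlgebra S L]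
    (i : M →ₗ[S] L) : UniversalEnvelopingAlgebra S L :=
  mulMap ((UniversalEnvelopingAlgebra.ι S : L →ₗ⁅S⁆ UniversalEnvelopingAlgebra S L).toLinearMap ∘ₗ i)
    ((UniversalEnvelopingAlgebra.ι S : L →ₗ⁅S⁆ UniversalEnvelopingAlgebra S L).toLinearMap ∘ₗ i)
    hB.canonicalElement

lemma Unimodular.tensorEquivEnd_canonical (hB : Unimodular B) :
    hB.tensorEquivEnd hB.canonicalElement = LinearMap.id :=
  LinearEquiv.apply_symm_apply _ _

lemma Unimodular.map_left_canonical (hB : Unimodular B) (T : M →ₗ[S] M)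
    (hT : ∀ x y, B (T x) y = - B x (T y)) :
    TensorProduct.map T LinearMap.id hB.canonicalElement =
      - TensorProduct.map LinearMap.id T hB.canonicalElement := by
  apply hB.tensorEquivEnd.injective
  have h1 : ∀ w : M ⊗[S] M, hB.tensorEquivEnd (TensorProduct.map T LinearMap.id w) =
      - (hB.tensorEquivEnd w) ∘ₗ T := by
    intro w
    induction w with
    | zero => simp
    | tmul x y => ext b; simp [hB.tensorEquivEnd_tmul, hT]
    | add u v hu hv => simp only [map_add, hu, hv]; ext; simp; abel
  have h2 : ∀ w : M ⊗[S] M, hB.tensorEquivEnd (TensorProduct.map LinearMap.id T w) =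
      T ∘ₗ (hB.tensorEquivEnd w) := by
    intro w
    induction w with
    | zero => simp
    | tmul x y => ext b; simp [hB.tensorEquivEnd_tmul]
    | add u v hu hv => simp only [map_add, hu, hv]; ext; simp
  rw [map_neg, h1, h2, hB.tensorEquivEnd_canonical]
  ext; simp

lemma Unimodular.contract_right (hB : Unimodular B) (v : M) :
    TensorProduct.rid S M (TensorProduct.map LinearMap.id (B v) hB.canonicalElement) = v := by
  apply hB.injective
  ext c
  have h : ∀ w : M ⊗[S] M, B (TensorProduct.rid S M (TensorProduct.map LinearMap.id (B v) w)) c =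
      B v (hB.tensorEquivEnd w c) := by
    intro w
    induction w with
    | zero => simp
    | tmul x y => simp [hB.tensorEquivEnd_tmul, mul_comm]
    | add u v hu hv => simp only [map_add, LinearMap.add_apply, hu, hv]
  rw [h, hB.tensorEquivEnd_canonical]; rfl

end Canonical

section Clifford

lemma skew_apply {B : BilinForm S M} {T : Module.End S M} (hT : T ∈ skewAdjointLieSubalgebra B) (x y : M) :
    B (T x) y = - B x (T y) := by
  have h : LinearMap.IsSkewAdjoint B T := (LinearMap.mem_skewAdjointSubmodule T).1 hT
  simpa using h x y

variable [Algebra ℂ S]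

/-- The quadratic form `x ↦ B(x, x) / 2`. -/
def halfForm (B : BilinForm S M) : QuadraticForm S M :=
  algebraMap ℂ S (1 / 2) • LinearMap.BilinMap.toQuadraticMap B

/-- The Clifford algebra `Cl(M, B)` of a symmetric form, with the convention
`x y + y x = B(x, y)`, see `gamma_mul_add`. -/
abbrev Cl (B : BilinForm S M) : Type _ := CliffordAlgebra (halfForm B)

/-- The canonical map `γ : M → Cl(M, B)`. -/
def gamma (B : BilinForm S M) : M →ₗ[S] Cl B := CliffordAlgebra.ι (halfForm B)

lemma gamma_mul_add {B : BilinForm S M} (hs : ∀ x y, B x y = B y x) (x y : M) :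
    gamma B x * gamma B y + gamma B y * gamma B x = algebraMap S (Cl B) (B x y) := by
  rw [gamma, CliffordAlgebra.ι_mul_ι_add_swap]
  congr 1
  have h2 : algebraMap ℂ S (1 / 2) * 2 = 1 := by
    rw [← map_ofNat (algebraMap ℂ S) 2, ← map_mul]; simp
  simp only [QuadraticMap.polar, halfForm, smul_apply,
    LinearMap.BilinMap.toQuadraticMap_apply, map_add, LinearMap.add_apply, smul_eq_mul, hs y x]
  linear_combination (B x y) * h2

variable [Module.Finite S M] [Module.Projective S M] {B : BilinForm S M}

/-- The linear map `T ↦ ½ ∑ᵢ γ(T eᵢ') γ(eᵢ)`, where `∑ᵢ eᵢ' ⊗ eᵢ = ω(M, B)`. -/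
def Unimodular.phiLin (hB : Unimodular B) : Module.End S M →ₗ[S] Cl B where
  toFun T := algebraMap ℂ S (1 / 2) • mulMap (gamma B ∘ₗ T) (gamma B) hB.canonicalElement
  map_add' T T' := by
    rw [← smul_add]; congr 1
    generalize hB.canonicalElement = w
    induction w with
    | zero => simp
    | tmul x y => simp [add_mul]
    | add u v hu hv => rw [map_add, map_add, map_add, hu, hv]; abel
  map_smul' c T := by
    rw [RingHom.id_apply, smul_comm c]; congr 1
    generalize hB.canonicalElement = w
    induction w with
    | zero => simp
    | tmul x y => simp
    | add u v hu hv => rw [map_add, map_add, hu, hv, smul_add]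

lemma Unimodular.phiLin_apply (hB : Unimodular B) (T : Module.End S M) :
    hB.phiLin T =
      algebraMap ℂ S (1 / 2) • mulMap (gamma B ∘ₗ T) (gamma B) hB.canonicalElement := rfl

/-- The value of `φ` on the elementary operator `v ↦ B(b, v) a - B(a, v) b` is
`½ [γ(a), γ(b)]`; these operators span the orthogonal Lie algebra, so this property determines
`φ`. -/
lemma Unimodular.phiLin_elementary (hB : Unimodular B) (hs : ∀ x y, B x y = B y x) (a b : M) :
    hB.phiLin ((B b).smulRight a - (B a).smulRight b) =
      algebraMap ℂ S (1 / 2) • ⁅gamma B a, gamma B b⁆ := by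
  rw [hB.phiLin_apply]
  congr 1
  have h : ∀ c d : M, mulMap (gamma B ∘ₗ (B c).smulRight d) (gamma B) hB.canonicalElement =
      gamma B d * gamma B c := by
    intro c d
    have : ∀ w : M ⊗[S] M, mulMap (gamma B ∘ₗ (B c).smulRight d) (gamma B) w =
        gamma B d * gamma B (hB.tensorEquivEnd w c) := by
      intro w
      induction w with
      | zero => simp
      | tmul x y => simp [hB.tensorEquivEnd_tmul, hs c x]
      | add u v hu hv => simp only [map_add, hu, hv, LinearMap.add_apply, mul_add]
    rw [this, hB.tensorEquivEnd_canonical]; rfl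
  have h' : mulMap (gamma B ∘ₗ ((B b).smulRight a - (B a).smulRight b)) (gamma B)
      hB.canonicalElement =
      mulMap (gamma B ∘ₗ (B b).smulRight a) (gamma B) hB.canonicalElement -
      mulMap (gamma B ∘ₗ (B a).smulRight b) (gamma B) hB.canonicalElement := by
    generalize hB.canonicalElement = w
    induction w with
    | zero => simp
    | tmul x y => simp [sub_mul]
    | add u v hu hv => rw [map_add, map_add, map_add, hu, hv]; abel
  rw [h', h, h, LieRing.of_associative_ring_bracket]

lemma Unimodular.phiLin_commutator (hB : Unimodular B) (hs : ∀ x y, B x y = B y x)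
    {T : Module.End S M} (hT : T ∈ skewAdjointLieSubalgebra B) (v : M) :
    hB.phiLin T * gamma B v - gamma B v * hB.phiLin T = gamma B (T v) := by
  rw [hB.phiLin_apply, smul_mul_assoc, mul_smul_comm, ← smul_sub]
  have h : ∀ w : M ⊗[S] M, mulMap (gamma B ∘ₗ T) (gamma B) w * gamma B v -
      gamma B v * mulMap (gamma B ∘ₗ T) (gamma B) w =
      gamma B (T (TensorProduct.rid S M (TensorProduct.map LinearMap.id (B v) w))) +
        gamma B (hB.tensorEquivEnd w (T v)) := by
    intro w
    induction w with
    | zero => simp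
    | tmul x y =>
      have e1 : gamma B y * gamma B v = algebraMap S _ (B v y) - gamma B v * gamma B y := by
        rw [← gamma_mul_add hs]; abel
      have e2 : gamma B v * gamma B (T x) =
          algebraMap S _ (- B x (T v)) - gamma B (T x) * gamma B v := by
        rw [← skew_apply hT, ← gamma_mul_add hs]; abel
      simp only [mulMap_tmul, LinearMap.comp_apply, mul_assoc, e1, mul_sub]
      rw [← mul_assoc (gamma B v), e2, ← Algebra.commutes, ← Algebra.smul_def]
      simp [hB.tensorEquivEnd_tmul, sub_mul, mul_assoc, Algebra.smul_def]
    | add u v hu hv =>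
      simp only [map_add, LinearMap.add_apply, add_mul, mul_add]
      rw [add_sub_add_comm, hu, hv]; abel
  rw [h, hB.contract_right, hB.tensorEquivEnd_canonical, LinearMap.id_apply, ← two_smul S,
    smul_smul]
  have h2 : algebraMap ℂ S (1 / 2) * 2 = 1 := by
    rw [← map_ofNat (algebraMap ℂ S) 2, ← map_mul]; simp
  rw [h2, one_smul]

/-- The Lie algebra morphism `φ : so(M, B) → Cl(M, B)`. -/
def Unimodular.phi (hB : Unimodular B) (hs : ∀ x y, B x y = B y x) :
    skewAdjointLieSubalgebra B →ₗ⁅S⁆ Cl B :=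
  { hB.phiLin ∘ₗ (skewAdjointLieSubalgebra B).toSubmodule.subtype with
    map_lie' := by
      rintro ⟨X, hX⟩ ⟨T, hT⟩
      change hB.phiLin ⁅X, T⁆ = ⁅hB.phiLin X, hB.phiLin T⁆
      rw [LieRing.of_associative_ring_bracket (hB.phiLin X)]
      have hc := fun v => hB.phiLin_commutator hs hX v
      generalize hB.phiLin X = p at hc
      rw [hB.phiLin_apply, hB.phiLin_apply, smul_mul_assoc, mul_smul_comm, ← smul_sub]
      congr 1
      have h : ∀ w : M ⊗[S] M, p * mulMap (gamma B ∘ₗ T) (gamma B) w -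
          mulMap (gamma B ∘ₗ T) (gamma B) w * p =
          mulMap (gamma B ∘ₗ X ∘ₗ T) (gamma B) w +
          mulMap (gamma B ∘ₗ T) (gamma B) (TensorProduct.map LinearMap.id X w) := by
        intro w
        induction w with
        | zero => simp
        | tmul x y =>
          simp only [mulMap_tmul, LinearMap.comp_apply, TensorProduct.map_tmul,
            LinearMap.id_apply, ← hc]
          noncomm_ring
        | add u v hu hv =>
          simp only [map_add, add_mul, mul_add]
          rw [add_sub_add_comm, hu, hv]; abel
      rw [h, eq_comm, ← sub_eq_zero]
      rw [← neg_eq_iff_eq_neg.2 (hB.map_left_canonical X (skew_apply hX))]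
      generalize hB.canonicalElement = w
      induction w with
      | zero => simp
      | tmul x y => simp [LieRing.of_associative_ring_bracket, sub_mul]
      | add u v hu hv =>
        simp only [map_add, neg_add]
        rw [← add_zero (0 : Cl B)]
        nth_rewrite 1 [← hu]
        rw [← hv]
        abel }

end Clifford

section Restriction

lemma unimodular_restrict {B : BilinForm S M} (hB : Unimodular B) (e : M →ₗ[S] M)
    (he : ∀ x y, B (e x) y = B x (e y)) {N : Submodule S M} (h1 : ∀ x ∈ N, e x = x)
    (h2 : ∀ x, e x ∈ N) : Unimodular (pullForm B N.subtype) := by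
  constructor
  · rw [injective_iff_map_eq_zero]
    intro x hx
    apply Subtype.ext
    apply hB.injective
    ext y
    have h := LinearMap.congr_fun hx ⟨e y, h2 y⟩
    change B x (e y) = 0 at h
    rw [← he, h1 _ x.2] at h
    simp [h]
  · intro f
    obtain ⟨x, hx⟩ := hB.surjective (f ∘ₗ e.codRestrict N h2)
    refine ⟨⟨e x, h2 x⟩, ?_⟩
    ext y
    change B (e x) y = f y
    rw [he, h1 _ y.2]
    have h := LinearMap.congr_fun hx y
    rw [h]
    change f ⟨e y, _⟩ = f y
    congr 1
    exact Subtype.ext (h1 _ y.2)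

lemma unimodular_pull_equiv {N : Type*} [AddCommGroup N] [Module S N] {B : BilinForm S M}
    (hB : Unimodular B) (j : N ≃ₗ[S] M) : Unimodular (pullForm B (j : N →ₗ[S] M)) := by
  have h : (pullForm B (j : N →ₗ[S] M) : N →ₗ[S] Module.Dual S N) =
      (j.dualMap : _ →ₗ[S] _) ∘ₗ (B : M →ₗ[S] Module.Dual S M) ∘ₗ (j : N →ₗ[S] M) := by
    ext; rfl
  unfold Unimodular
  rw [h]
  exact j.dualMap.bijective.comp (hB.comp j.bijective)

end Restriction

end Generic

section BaseChange

variable (R : Type*) [CommRing R] [Algebra ℂ R] {V : Type*} [AddCommGroup V] [Module ℂ V]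

lemma unimodular_of_nondegenerate [FiniteDimensional ℂ V] {B : BilinForm ℂ V}
    (hB : B.Nondegenerate) : Unimodular B :=
  (B.toDual hB).bijective

lemma unimodular_baseChange [FiniteDimensional ℂ V] {B : BilinForm ℂ V} (hB : Unimodular B) :
    Unimodular (B.baseChange R) := by
  classical
  let b := Module.finBasis ℂ V
  let b' := b.dualBasis.map hB.toDual.symm
  have hbb : ∀ i j, B (b' i) (b j) = if j = i then 1 else 0 := by
    intro i j
    have : B (b' i) = b.dualBasis i := hB.toDual.apply_symm_apply _
    rw [this]
    simp [Finsupp.single_apply]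
  have hbb' : ∀ i j, B.baseChange R (b'.baseChange R i) (b.baseChange R j) =
      if j = i then 1 else 0 := by
    intro i j
    simp only [Module.Basis.baseChange_apply, LinearMap.BilinForm.baseChange_tmul, hbb]
    split_ifs <;> simp
  constructor
  · rw [injective_iff_map_eq_zero]
    intro x hx
    rw [← (b'.baseChange R).sum_repr x] at hx ⊢
    refine Finset.sum_eq_zero fun j _ => ?_
    have h := LinearMap.congr_fun hx (b.baseChange R j)
    rw [map_sum, LinearMap.sum_apply] at h
    simp only [map_smul, LinearMap.smul_apply, hbb', LinearMap.zero_apply] at h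
    simp only [smul_eq_mul, mul_ite, mul_one, mul_zero, Finset.sum_ite_eq, Finset.mem_univ,
      if_true] at h
    rw [h, zero_smul]
  · intro f
    refine ⟨∑ i, f (b.baseChange R i) • b'.baseChange R i, ?_⟩
    refine (b.baseChange R).ext fun j => ?_
    rw [map_sum, LinearMap.sum_apply]
    simp only [map_smul, LinearMap.smul_apply, hbb']
    simp

lemma baseChange_fix {e : V →ₗ[ℂ] V} {N : Submodule ℂ V} (h1 : ∀ x ∈ N, e x = x)
    (x : R ⊗[ℂ] V) (hx : x ∈ N.baseChange R) : e.baseChange R x = x := by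
  rw [Submodule.baseChange_eq_span] at hx
  induction hx using Submodule.span_induction with
  | mem x hx =>
    obtain ⟨y, hy, rfl⟩ := hx
    simp [h1 y hy]
  | zero => simp
  | add x y _ _ hx hy => rw [map_add, hx, hy]
  | smul a x _ hx => rw [map_smul, hx]

lemma baseChange_mem {e : V →ₗ[ℂ] V} {N : Submodule ℂ V} (h2 : ∀ x, e x ∈ N)
    (x : R ⊗[ℂ] V) : e.baseChange R x ∈ N.baseChange R := by
  induction x with
  | zero => simp
  | tmul a v => exact Submodule.tmul_mem_baseChange_of_mem a (h2 v)
  | add x y hx hy => rw [map_add]; exact add_mem hx hy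

lemma baseChange_selfAdjoint {B : BilinForm ℂ V} {e : V →ₗ[ℂ] V}
    (he : ∀ x y, B (e x) y = B x (e y)) (x y : R ⊗[ℂ] V) :
    B.baseChange R (e.baseChange R x) y = B.baseChange R x (e.baseChange R y) := by
  induction x with
  | zero => simp
  | tmul a v =>
    induction y with
    | zero => simp
    | tmul b w => simp [he]
    | add x y hx hy => simp only [map_add, hx, hy]
  | add x y hx hy => simp only [map_add, LinearMap.add_apply, hx, hy]

lemma unimodular_baseChange_restrict [FiniteDimensional ℂ V] {B : BilinForm ℂ V}
    (hB : B.Nondegenerate) {e : V →ₗ[ℂ] V} (he : ∀ x y, B (e x) y = B x (e y))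
    {N : Submodule ℂ V} (h1 : ∀ x ∈ N, e x = x) (h2 : ∀ x, e x ∈ N) :
    Unimodular (pullForm (M := R ⊗[ℂ] V) (N := ↥(N.baseChange R)) (B.baseChange R)
      (N.baseChange R).subtype) :=
  unimodular_restrict (unimodular_baseChange R (unimodular_of_nondegenerate hB))
    (e.baseChange R) (baseChange_selfAdjoint R he) (baseChange_fix R h1) (baseChange_mem R h2)

variable {L : Type*} [LieRing L] [LieAlgebra ℂ L]

lemma lie_mem_baseChange {a b c : Submodule ℂ L} (h : ∀ x ∈ a, ∀ y ∈ b, ⁅x, y⁆ ∈ c)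
    {x y : R ⊗[ℂ] L} (hx : x ∈ a.baseChange R) (hy : y ∈ b.baseChange R) :
    ⁅x, y⁆ ∈ c.baseChange R := by
  rw [Submodule.baseChange_eq_span] at hx hy
  induction hx using Submodule.span_induction with
  | mem x hx =>
    obtain ⟨u, hu, rfl⟩ := hx
    induction hy using Submodule.span_induction with
    | mem y hy =>
      obtain ⟨v, hv, rfl⟩ := hy
      exact Submodule.tmul_mem_baseChange_of_mem _ (h u hu v hv)
    | zero => simp
    | add y z _ _ hy hz => rw [lie_add]; exact add_mem hy hz
    | smul a y _ hy => rw [lie_smul]; exact Submodule.smul_mem _ _ hy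
  | zero => simp
  | add y z _ _ hy hz => rw [add_lie]; exact add_mem hy hz
  | smul a y _ hy => rw [smul_lie]; exact Submodule.smul_mem _ _ hy

lemma baseChange_lie {B : BilinForm ℂ L} (h : ∀ x y z, B ⁅x, y⁆ z = B x ⁅y, z⁆)
    (x y z : R ⊗[ℂ] L) : B.baseChange R ⁅x, y⁆ z = B.baseChange R x ⁅y, z⁆ := by
  induction x with
  | zero => simp
  | tmul a u =>
    induction y with
    | zero => simp
    | tmul b v =>
      induction z with
      | zero => simp
      | tmul c w =>
        simp only [LieAlgebra.ExtendScalars.bracket_tmul, LinearMap.BilinForm.baseChange_tmul, h,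
          mul_assoc]
      | add x y hx hy => simp only [lie_add, map_add, hx, hy]
    | add x y hx hy => simp only [lie_add, add_lie, map_add, LinearMap.add_apply, hx, hy]
  | add x y hx hy => simp only [add_lie, map_add, LinearMap.add_apply, hx, hy]

lemma baseChange_map_lie {U : Type*} [Ring U] [Algebra ℂ U] (f : L →ₗ[ℂ] U)
    (hf : ∀ x y, f ⁅x, y⁆ = f x * f y - f y * f x) (x y : R ⊗[ℂ] L) :
    f.baseChange R ⁅x, y⁆ = f.baseChange R x * f.baseChange R y -
      f.baseChange R y * f.baseChange R x := by
  induction x with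
  | zero => simp
  | tmul a u =>
    induction y with
    | zero => simp
    | tmul b v =>
      simp [LieAlgebra.ExtendScalars.bracket_tmul, hf, TensorProduct.tmul_sub, mul_comm a b]
    | add x y hx hy =>
      simp only [lie_add, map_add, hx, hy, mul_add, add_mul]
      abel
  | add x y hx hy =>
    simp only [add_lie, map_add, hx, hy, mul_add, add_mul]
    abel

lemma baseChange_symm {B : BilinForm ℂ V} (h : ∀ x y, B x y = B y x)
    (x y : R ⊗[ℂ] V) : B.baseChange R x y = B.baseChange R y x := by
  induction x with
  | zero => simp
  | tmul a v =>
    induction y with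
    | zero => simp
    | tmul b w => simp [h v w, mul_comm]
    | add x y hx hy => simp only [map_add, LinearMap.add_apply, hx, hy]
  | add x y hx hy => simp only [map_add, LinearMap.add_apply, hx, hy]

end BaseChange

/-- A complex Lie algebra `𝔤` with an involutive automorphism `θ` and a symmetric, `𝔤`-invariant,
`θ`-invariant and nondegenerate bilinear form `β`. -/
structure QuadraticPair (𝔤 : Type*) [LieRing 𝔤] [LieAlgebra ℂ 𝔤] where
  /-- the involution -/
  θ : 𝔤 →ₗ⁅ℂ⁆ 𝔤
  θ_θ : ∀ x, θ (θ x) = x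
  /-- the invariant form -/
  β : BilinForm ℂ 𝔤
  β_symm : ∀ x y, β x y = β y x
  β_lie : ∀ x y z, β ⁅x, y⁆ z = β x ⁅y, z⁆
  β_θ : ∀ x y, β (θ x) (θ y) = β x y
  β_nondegenerate : β.Nondegenerate

namespace QuadraticPair

section Constant

variable {𝔤 : Type*} [LieRing 𝔤] [LieAlgebra ℂ 𝔤] (X : QuadraticPair 𝔤)

/-- The fixed point subalgebra `𝔨` of `θ`. -/
def k : LieSubalgebra ℂ 𝔤 where
  carrier := {x | X.θ x = x}
  add_mem' hx hy := by
    change X.θ _ = _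
    rw [map_add, hx, hy]
  zero_mem' := map_zero X.θ
  smul_mem' c x hx := by
    change X.θ _ = _
    rw [map_smul, hx]
  lie_mem' hx hy := by
    change X.θ _ = _
    rw [LieHom.map_lie]
    exact congrArg₂ _ hx hy

/-- The `-1` eigenspace `𝔭` of `θ`. -/
def p : Submodule ℂ 𝔤 where
  carrier := {x | X.θ x = -x}
  add_mem' hx hy := by
    change X.θ _ = _
    rw [map_add, hx, hy, neg_add]
  zero_mem' := by simp
  smul_mem' c x hx := by
    change X.θ _ = _
    rw [map_smul, hx, smul_neg]

lemma mem_k {x : 𝔤} : x ∈ X.k ↔ X.θ x = x := Iff.rfl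

lemma mem_p {x : 𝔤} : x ∈ X.p ↔ X.θ x = -x := Iff.rfl

lemma lie_kk {x y : 𝔤} (hx : x ∈ X.k.toSubmodule) (hy : y ∈ X.k.toSubmodule) :
    ⁅x, y⁆ ∈ X.k.toSubmodule :=
  X.k.lie_mem hx hy

lemma lie_kp {x y : 𝔤} (hx : x ∈ X.k.toSubmodule) (hy : y ∈ X.p) : ⁅x, y⁆ ∈ X.p := by
  have hx' : X.θ x = x := hx
  rw [mem_p] at *
  rw [LieHom.map_lie, hx', hy, lie_neg]

lemma lie_pp {x y : 𝔤} (hx : x ∈ X.p) (hy : y ∈ X.p) : ⁅x, y⁆ ∈ X.k.toSubmodule := by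
  rw [mem_p] at *
  change X.θ _ = _
  rw [LieHom.map_lie, hx, hy, lie_neg, neg_lie, neg_neg]

/-- The projections of `𝔤` to `𝔨` (for `c = 1`) and to `𝔭` (for `c = -1`). -/
def proj (c : ℂ) : 𝔤 →ₗ[ℂ] 𝔤 :=
  (1 / 2 : ℂ) • (LinearMap.id + c • (X.θ : 𝔤 →ₗ[ℂ] 𝔤))

lemma proj_apply (c : ℂ) (x : 𝔤) : X.proj c x = (1 / 2 : ℂ) • (x + c • X.θ x) := rfl

lemma proj_selfAdjoint (c : ℂ) (x y : 𝔤) : X.β (X.proj c x) y = X.β x (X.proj c y) := by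
  have h : X.β (X.θ x) y = X.β x (X.θ y) := by
    rw [← X.β_θ, X.θ_θ]
  simp [proj_apply, h]

lemma proj_k (x : 𝔤) (hx : x ∈ X.k.toSubmodule) : X.proj 1 x = x := by
  have hx' : X.θ x = x := hx
  rw [proj_apply, hx', one_smul, ← two_smul ℂ, smul_smul]
  simp

lemma proj_p (x : 𝔤) (hx : x ∈ X.p) : X.proj (-1) x = x := by
  rw [mem_p] at hx
  rw [proj_apply, hx, neg_one_smul, neg_neg, ← two_smul ℂ, smul_smul]
  simp

lemma proj_mem_k (x : 𝔤) : X.proj 1 x ∈ X.k.toSubmodule := by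
  change X.θ _ = _
  simp [proj_apply, X.θ_θ, add_comm]

lemma proj_mem_p (x : 𝔤) : X.proj (-1) x ∈ X.p := by
  rw [mem_p, proj_apply, map_smul, map_add, map_smul, X.θ_θ, ← smul_neg]
  congr 1
  simp

end Constant

section Family

attribute [local instance 2000] LieRing.ofAssociativeRing

variable {𝔤 : Type*} [LieRing 𝔤] [LieAlgebra ℂ 𝔤] (X : QuadraticPair 𝔤)
variable (R : Type*) [CommRing R] [Algebra ℂ R]

/-- The `R`-bilinear extension `1 ⊗ β` of `β` to the constant family `R ⊗ 𝔤`. -/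
def βR : BilinForm R (R ⊗[ℂ] 𝔤) := X.β.baseChange R

/-- The constant family `R ⊗ 𝔨`, a Lie subalgebra of `R ⊗ 𝔤`. -/
def kFam : LieSubalgebra R (R ⊗[ℂ] 𝔤) :=
  { X.k.toSubmodule.baseChange R with
    lie_mem' := fun hx hy =>
      lie_mem_baseChange R (fun _ h _ h' => X.lie_kk h h') hx hy }

variable {R}

/-- The `R`-submodule `⟨r⟩ ⊗ 𝔭` of `R ⊗ 𝔤`. -/
def pFam (r : R) : Submodule R (R ⊗[ℂ] 𝔤) :=
  Ideal.span {r} • X.p.baseChange R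

lemma mem_pFam {r : R} {x : R ⊗[ℂ] 𝔤} :
    x ∈ X.pFam r ↔ ∃ y ∈ X.p.baseChange R, r • y = x := by
  rw [pFam, Submodule.ideal_span_singleton_smul, Submodule.mem_smul_pointwise_iff_exists]

lemma lie_kFam_pFam {r : R} {x y : R ⊗[ℂ] 𝔤} (hx : x ∈ X.kFam R) (hy : y ∈ X.pFam r) :
    ⁅x, y⁆ ∈ X.pFam r := by
  obtain ⟨z, hz, rfl⟩ := X.mem_pFam.1 hy
  rw [lie_smul]
  exact X.mem_pFam.2 ⟨_, lie_mem_baseChange R (fun _ h _ h' => X.lie_kp h h') hx hz, rfl⟩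

lemma lie_pFam_pFam {r : R} {x y : R ⊗[ℂ] 𝔤} (hx : x ∈ X.pFam r) (hy : y ∈ X.pFam r) :
    ⁅x, y⁆ ∈ X.kFam R := by
  obtain ⟨z, hz, rfl⟩ := X.mem_pFam.1 hx
  obtain ⟨w, hw, rfl⟩ := X.mem_pFam.1 hy
  rw [lie_smul, smul_lie]
  refine (X.kFam R).smul_mem _ ((X.kFam R).smul_mem _ ?_)
  exact lie_mem_baseChange R (fun _ h _ h' => X.lie_pp h h') hz hw

/-- The family `(R ⊗ 𝔨) ⊕ (⟨r⟩ ⊗ 𝔭)`, a Lie subalgebra of `R ⊗ 𝔤`. -/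
def gFam (r : R) : LieSubalgebra R (R ⊗[ℂ] 𝔤) :=
  { (X.kFam R).toSubmodule ⊔ X.pFam r with
    lie_mem' := by
      intro x y hx hy
      obtain ⟨a, ha, b, hb, rfl⟩ := Submodule.mem_sup.1 hx
      obtain ⟨c, hc, d, hd, rfl⟩ := Submodule.mem_sup.1 hy
      rw [add_lie, lie_add, lie_add, ← lie_skew b c]
      refine add_mem (add_mem ?_ ?_) (add_mem (Submodule.neg_mem _ ?_) ?_)
      · exact Submodule.mem_sup_left ((X.kFam R).lie_mem ha hc)
      · exact Submodule.mem_sup_right (X.lie_kFam_pFam ha hd)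
      · exact Submodule.mem_sup_right (X.lie_kFam_pFam hc hb)
      · exact Submodule.mem_sup_left (X.lie_pFam_pFam hb hd) }

/-- The inclusion of `R ⊗ 𝔨` in the family. -/
def kIncl (r : R) : X.kFam R →ₗ⁅R⁆ X.gFam r :=
  LieSubalgebra.inclusion (show X.kFam R ≤ X.gFam r from
    fun _ hx => Submodule.mem_sup_left (S := (X.kFam R).toSubmodule) hx)

/-- The inclusion of `⟨r⟩ ⊗ 𝔭` in the family. -/
def pIncl (r : R) : X.pFam r →ₗ[R] X.gFam r :=
  Submodule.inclusion (show X.pFam r ≤ (X.gFam r).toSubmodule from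
    fun _ hx => Submodule.mem_sup_right hx)

/-- The restriction of `1 ⊗ β` to `R ⊗ 𝔨`. -/
def βk (R : Type*) [CommRing R] [Algebra ℂ R] : BilinForm R (X.kFam R) :=
  pullForm (X.βR R) (X.kFam R).toSubmodule.subtype

/-- The canonical morphism from the enveloping algebra of the family to `R ⊗ U(𝔤) = U(R ⊗ 𝔤)`
that extends the inclusion of the family in `R ⊗ 𝔤`. -/
def toConstant (r : R) :
    UniversalEnvelopingAlgebra R (X.gFam r) →ₐ[R] R ⊗[ℂ] UniversalEnvelopingAlgebra ℂ 𝔤 :=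
  UniversalEnvelopingAlgebra.lift R
    { (LinearMap.baseChange R
        (UniversalEnvelopingAlgebra.ι ℂ : 𝔤 →ₗ⁅ℂ⁆ UniversalEnvelopingAlgebra ℂ 𝔤).toLinearMap) ∘ₗ
        (X.gFam r).toSubmodule.subtype with
      map_lie' := by
        intro x y
        exact baseChange_map_lie R
          (UniversalEnvelopingAlgebra.ι ℂ : 𝔤 →ₗ⁅ℂ⁆ UniversalEnvelopingAlgebra ℂ 𝔤).toLinearMap
          (LieHom.map_lie _) _ _ }

lemma βk_unimodular [FiniteDimensional ℂ 𝔤] : Unimodular (X.βk R) :=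
  unimodular_baseChange_restrict R X.β_nondegenerate (X.proj_selfAdjoint 1) X.proj_k X.proj_mem_k

variable [IsDomain R]

/-- The isomorphism `T_r : R ⊗ 𝔭 ≃ ⟨r⟩ ⊗ 𝔭` given by multiplication by `r`. -/
def Tr {r : R} (hr : r ≠ 0) : X.p.baseChange R ≃ₗ[R] X.pFam r :=
  LinearEquiv.ofBijective
    ((r • (X.p.baseChange R).subtype).codRestrict (X.pFam r)
      fun y => X.mem_pFam.2 ⟨y, y.2, rfl⟩) (by
    constructor
    · intro x y h
      have h' : r • (x : R ⊗[ℂ] 𝔤) = r • (y : R ⊗[ℂ] 𝔤) := congrArg Subtype.val h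
      exact Subtype.ext (smul_right_injective _ hr h')
    · rintro ⟨x, hx⟩
      obtain ⟨y, hy, rfl⟩ := X.mem_pFam.1 hx
      exact ⟨⟨y, hy⟩, rfl⟩)

lemma coe_Tr {r : R} (hr : r ≠ 0) (y : X.p.baseChange R) :
    (X.Tr hr y : R ⊗[ℂ] 𝔤) = r • (y : R ⊗[ℂ] 𝔤) := rfl

/-- The form `β^r` on `⟨r⟩ ⊗ 𝔭`, obtained by transporting the restriction of `1 ⊗ β` to `R ⊗ 𝔭`
along `T_r`. By `sq_mul_βr` it is the only form with `(1 ⊗ β)(x, y) = r² β^r(x, y)`. -/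
def βr {r : R} (hr : r ≠ 0) : BilinForm R (X.pFam r) :=
  pullForm (pullForm (X.βR R) (X.p.baseChange R).subtype) (X.Tr hr).symm.toLinearMap

lemma sq_mul_βr {r : R} (hr : r ≠ 0) (x y : X.pFam r) :
    r ^ 2 * X.βr hr x y = X.βR R x y := by
  obtain ⟨x, rfl⟩ := (X.Tr hr).surjective x
  obtain ⟨y, rfl⟩ := (X.Tr hr).surjective y
  rw [coe_Tr, coe_Tr]
  simp [βr, pullForm]
  ring

lemma βr_symm {r : R} (hr : r ≠ 0) (x y : X.pFam r) : X.βr hr x y = X.βr hr y x :=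
  baseChange_symm R X.β_symm _ _

/-- The adjoint action of `R ⊗ 𝔨` on `⟨r⟩ ⊗ 𝔭`, as a morphism to `so(⟨r⟩ ⊗ 𝔭, β^r)`. -/
def ad {r : R} (hr : r ≠ 0) : X.kFam R →ₗ⁅R⁆ skewAdjointLieSubalgebra (X.βr hr) where
  toFun x :=
    ⟨{ toFun := fun y => ⟨⁅(x : R ⊗[ℂ] 𝔤), (y : R ⊗[ℂ] 𝔤)⁆, X.lie_kFam_pFam x.2 y.2⟩
       map_add' := fun y z => Subtype.ext (lie_add _ _ _)
       map_smul' := fun c y => Subtype.ext (lie_smul _ _ _) }, by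
      refine (LinearMap.mem_skewAdjointSubmodule _).2 fun y z => ?_
      apply mul_left_cancel₀ (pow_ne_zero 2 hr)
      rw [X.sq_mul_βr hr, X.sq_mul_βr hr]
      change X.βR R ⁅(x : R ⊗[ℂ] 𝔤), (y : R ⊗[ℂ] 𝔤)⁆ z =
        X.βR R y (-⁅(x : R ⊗[ℂ] 𝔤), (z : R ⊗[ℂ] 𝔤)⁆)
      rw [← lie_skew, map_neg, LinearMap.neg_apply, map_neg, βR, baseChange_lie R X.β_lie]⟩
  map_add' x y := Subtype.ext (LinearMap.ext fun z => Subtype.ext (add_lie _ _ _))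
  map_smul' c x := Subtype.ext (LinearMap.ext fun z => Subtype.ext (smul_lie _ _ _))
  map_lie' {x y} := Subtype.ext (LinearMap.ext fun z => Subtype.ext (by
    exact lie_lie (x : R ⊗[ℂ] 𝔤) (y : R ⊗[ℂ] 𝔤) (z : R ⊗[ℂ] 𝔤)))

variable [FiniteDimensional ℂ 𝔤]

lemma βr_unimodular {r : R} (hr : r ≠ 0) : Unimodular (X.βr hr) :=
  unimodular_pull_equiv (unimodular_baseChange_restrict R X.β_nondegenerate
    (X.proj_selfAdjoint (-1)) X.proj_p X.proj_mem_p) _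

variable [IsPrincipalIdealRing R]

instance : Module.Finite R (X.kFam R) :=
  inferInstanceAs (Module.Finite R (X.kFam R).toSubmodule)

instance : Module.Free R (X.kFam R) :=
  inferInstanceAs (Module.Free R (X.kFam R).toSubmodule)

/-- The morphism of Lie algebras `α = φ ∘ ad` from `R ⊗ 𝔨` to `Cl(⟨r⟩ ⊗ 𝔭, β^r)`. -/
def α {r : R} (hr : r ≠ 0) : X.kFam R →ₗ⁅R⁆ Cl (X.βr hr) :=
  ((X.βr_unimodular hr).phi (X.βr_symm hr)).comp (X.ad hr)

/-- The algebra `A = U((R ⊗ 𝔨) ⊕ (⟨r⟩ ⊗ 𝔭)) ⊗ Cl(⟨r⟩ ⊗ 𝔭, β^r)` over `R`. -/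
abbrev A {r : R} (hr : r ≠ 0) : Type _ :=
  UniversalEnvelopingAlgebra R (X.gFam r) ⊗[R] Cl (X.βr hr)

/-- The diagonal embedding `Δ(x) = x ⊗ 1 + 1 ⊗ α(x)` of `R ⊗ 𝔨` in `A`. -/
def Δ {r : R} (hr : r ≠ 0) : X.kFam R →ₗ⁅R⁆ X.A hr where
  toFun x := UniversalEnvelopingAlgebra.ι R (X.kIncl r x) ⊗ₜ[R] 1 + 1 ⊗ₜ[R] X.α hr x
  map_add' x y := by
    simp only [map_add, TensorProduct.add_tmul, TensorProduct.tmul_add]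
    abel
  map_smul' c x := by
    simp only [map_smul, TensorProduct.smul_tmul', TensorProduct.tmul_smul, smul_add,
      RingHom.id_apply]
  map_lie' {x y} := by
    simp only [LieHom.map_lie, LieRing.of_associative_ring_bracket, TensorProduct.sub_tmul,
      TensorProduct.tmul_sub, add_mul, mul_add, Algebra.TensorProduct.tmul_mul_tmul, one_mul,
      mul_one]
    abel

/-- The extension of the diagonal embedding to the enveloping algebra of `R ⊗ 𝔨`. -/
def ΔU {r : R} (hr : r ≠ 0) : UniversalEnvelopingAlgebra R (X.kFam R) →ₐ[R] X.A hr :=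
  UniversalEnvelopingAlgebra.lift R (X.Δ hr)

/-- The Casimir element `Ω(R ⊗ 𝔨, 1 ⊗ β_𝔨)` in the enveloping algebra of `R ⊗ 𝔨`. -/
def Ωk (R : Type*) [CommRing R] [Algebra ℂ R] [IsDomain R] [IsPrincipalIdealRing R] :
    UniversalEnvelopingAlgebra R (X.kFam R) :=
  (X.βk_unimodular (R := R)).casimir LinearMap.id

/-- The Casimir element `Ω(𝔤, β)` in the enveloping algebra of `𝔤`. -/
def Ωg : UniversalEnvelopingAlgebra ℂ 𝔤 :=
  (unimodular_of_nondegenerate X.β_nondegenerate).casimir LinearMap.id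

/-- The Casimir element of the family, `r² Ω(R ⊗ 𝔨, 1 ⊗ β_𝔨) + Ω(⟨r⟩ ⊗ 𝔭, β^r)`, as an element of
the enveloping algebra of the family. -/
def Ω {r : R} (hr : r ≠ 0) : UniversalEnvelopingAlgebra R (X.gFam r) :=
  r ^ 2 • (X.βk_unimodular (R := R)).casimir (X.kIncl r).toLinearMap +
    (X.βr_unimodular hr).casimir (X.pIncl r)

/-- The Dirac operator: the image of `ω(⟨r⟩ ⊗ 𝔭, β^r)` in `A`. -/
def D {r : R} (hr : r ≠ 0) : X.A hr :=
  TensorProduct.map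
    ((UniversalEnvelopingAlgebra.ι R :
      X.gFam r →ₗ⁅R⁆ UniversalEnvelopingAlgebra R (X.gFam r)).toLinearMap ∘ₗ X.pIncl r)
    (gamma (X.βr hr)) (X.βr_unimodular hr).canonicalElement

end Family

end QuadraticPair

section Roots

variable {L : Type*} [LieRing L] [LieAlgebra ℂ L] (H : LieSubalgebra ℂ L) [LieRing.IsNilpotent H]

/-- The roots of `L` with respect to `H`. -/
def IsRoot (α : Module.Dual ℂ H) : Prop :=
  α ≠ 0 ∧ LieAlgebra.rootSpace H α ≠ ⊥

/-- `P` is a positive system: a set of roots that contains exactly one of `α, -α` for each root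
`α`, and every root that is a sum of two of its members. -/
structure IsPositiveSystem (P : Finset (Module.Dual ℂ H)) : Prop where
  isRoot : ∀ α ∈ P, IsRoot H α
  xor : ∀ α, IsRoot H α → Xor (α ∈ P) (-α ∈ P)
  closed : ∀ α ∈ P, ∀ β ∈ P, IsRoot H (α + β) → α + β ∈ P

end Roots

/-- Half the sum of the elements of `P`. -/
def halfSum {V : Type*} [AddCommGroup V] [Module ℂ V] (P : Finset (Module.Dual ℂ V)) :
    Module.Dual ℂ V :=
  (1 / 2 : ℂ) • ∑ α ∈ P, α

/-- The value `B*(f, f)` of the form `B*` on the dual of `V` induced by a nondegenerate form `B`: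
`f(v)` for the vector `v` with `f = B(v, ·)`. -/
def dualNormSq {V : Type*} [AddCommGroup V] [Module ℂ V] [FiniteDimensional ℂ V]
    (B : BilinForm ℂ V) (hB : B.Nondegenerate) (f : Module.Dual ℂ V) : ℂ :=
  f ((B.toDual hB).symm f)

end DiracFamily

end

open DiracFamily

/-!
Fix dual families `xᵢ, xⁱ` of `𝔨` for `β` and `aⱼ, bⱼ` of `𝔭`; all the canonical elements in the
theorem are then finite sums over such families, and the families `1 ⊗ xᵢ` and `r ⊗ aⱼ` play the
same role over `R`. In particular `Ω(𝐠, β, r) = r² ∑ xᵢ xⁱ + r² ∑ aⱼ bⱼ` in `R ⊗ U(𝔤)`, which is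
`toConstant_Ω`.

For the square, write `xᵢ, xⁱ, aⱼ, bⱼ` also for the families over `R`. Then `xy + yx = β^r(x, y)` turns `2 D²` into `∑ aⱼ bⱼ ⊗ 1 + ∑ [aⱼ, aₗ] ⊗ γ(bⱼ) γ(bₗ)`
(`two_nsmul_dirac_sq`). Since `β([aⱼ, aₗ], x) = r² β^r([x, aⱼ], aₗ)`, the second sum is
`-2 r² ∑ xⁱ ⊗ α(xᵢ)` (`sum_moment_clifford`), and completing the square with
`Δ(Ω_𝔨) = ∑ (xᵢ + α(xᵢ)) (xⁱ + α(xⁱ))` leaves the term `r² ∑ α(xᵢ) α(xⁱ)`. By the Jacobi identity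
this Clifford element has no component of degree four, and it is the scalar `r² tr_𝔭(Ω_𝔨) / 8`
(`sum_spin_casimir`).

It remains to see that `tr_𝔭(Ω_𝔨) / 8 = ‖ρ‖² - ‖ρ_𝔨‖²`. The trace of `Ω(𝔤, β)` in the adjoint
representation of `𝔤` is `tr_𝔨(Ω_𝔨) + 3 tr_𝔭(Ω_𝔨)` (`casimirTrace_sum`), so that this is the
difference of two instances of the strange formula of Freudenthal and de Vries,
`24 ‖ρ‖² = tr_𝔤(Ω_𝔤)`, for `𝔤` and for `𝔨` (`casimirTrace_eq`). That formula follows in turn from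
the scalar computation above, applied to the adjoint action of a Lie algebra on itself: the product
of the positive root vectors in `Cl(𝔤, β)` is a highest weight vector of weight `ρ`, on which the
Casimir element acts by `‖ρ‖² + 2 ‖ρ‖²`, so that `3 ‖ρ‖² = tr_𝔤(Ω_𝔤) / 8`.

The strange formula needs Cartan subalgebras to be abelian and root spaces to have dimension one.
Both hold for a Lie algebra that has a module whose trace form is nondegenerate on the derived
algebra (`SeparatesDerived`). For `𝔤` the Killing form will do, by Cartan's criterion and because
`𝔤` carries an invariant nondegenerate form; it also serves for `𝔨`, acting on `𝔤`, because `𝔨` and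
`𝔭` are orthogonal for it.
-/

noncomputable section

namespace DiracFamily

/-! ### Dual families and sums in Clifford algebras -/

section DualFamilies

variable {S : Type*} [CommRing S] {M : Type*} [AddCommGroup M] [Module S M]
  {ι : Type*} [Fintype ι]

/-- Two finite families `x, y` in `M` are dual to each other for the symmetric form `B` if
`v = ∑ᵢ B(xᵢ, v) yᵢ = ∑ᵢ B(yᵢ, v) xᵢ` for all `v`. Neither family has to be a basis. -/
structure IsDualFamily (B : BilinForm S M) (x y : ι → M) : Prop where
  symm : ∀ u v, B u v = B v u
  left : ∀ v, ∑ i, B (x i) v • y i = v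
  right : ∀ v, ∑ i, B (y i) v • x i = v

namespace IsDualFamily

variable {B : BilinForm S M} {x y : ι → M} {N : Type*} [AddCommGroup N] [Module S N]

lemma swap (hd : IsDualFamily B x y) : IsDualFamily B y x := ⟨hd.symm, hd.right, hd.left⟩

lemma of_left (hs : ∀ u v, B u v = B v u) (hB : Function.Injective B)
    (h : ∀ v, ∑ i, B (x i) v • y i = v) : IsDualFamily B x y := by
  refine ⟨hs, h, fun v => hB (LinearMap.ext fun w => ?_)⟩
  conv_rhs => rw [← h w, map_sum]
  simp [hs v, mul_comm]

lemma sum_smul (hd : IsDualFamily B x y) (f : M →ₗ[S] N) (v : M) :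
    ∑ i, B (x i) v • f (y i) = f v := by
  conv_rhs => rw [← hd.left v, map_sum]
  simp

lemma sum_smul' (hd : IsDualFamily B x y) (f : M →ₗ[S] N) (v : M) :
    ∑ i, B v (x i) • f (y i) = f v := by
  simpa only [hd.symm v] using hd.sum_smul f v

/-- An operator moves from the first to the second of two dual families by passing to its
adjoint. -/
lemma sum_adjoint (hd : IsDualFamily B x y) (f : M →ₗ[S] M →ₗ[S] N) {T T' : M → M}
    (hT : ∀ u v, B (T u) v = B u (T' v)) :
    ∑ i, f (T (x i)) (y i) = ∑ i, f (x i) (T' (y i)) := by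
  have h1 : ∀ i, f (T (x i)) (y i) = ∑ j, B (y j) (T (x i)) • f (x j) (y i) := fun i => by
    simpa using (hd.swap.sum_smul (f.flip (y i)) (T (x i))).symm
  have h2 : ∀ j, f (x j) (T' (y j)) = ∑ i, B (x i) (T' (y j)) • f (x j) (y i) := fun j =>
    (hd.sum_smul (f (x j)) (T' (y j))).symm
  simp only [h1, h2]
  rw [Finset.sum_comm]
  refine Finset.sum_congr rfl fun j _ => Finset.sum_congr rfl fun i _ => ?_
  rw [← hT, hd.symm]

lemma sum_swap (hd : IsDualFamily B x y) (f : M →ₗ[S] M →ₗ[S] N) :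
    ∑ i, f (x i) (y i) = ∑ i, f (y i) (x i) := by
  have h1 : ∀ i, f (x i) (y i) = ∑ j, B (x j) (x i) • f (y j) (y i) := fun i => by
    simpa using (hd.sum_smul (f.flip (y i)) (x i)).symm
  have h2 : ∀ j, f (y j) (x j) = ∑ i, B (x i) (x j) • f (y j) (y i) := fun j =>
    (hd.sum_smul (f (y j)) (x j)).symm
  simp only [h1, h2]
  rw [Finset.sum_comm]
  refine Finset.sum_congr rfl fun j _ => Finset.sum_congr rfl fun i _ => ?_
  rw [hd.symm]

lemma canonicalElement_eq [Module.Finite S M] [Module.Projective S M] (hd : IsDualFamily B x y)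
    (hB : Unimodular B) : hB.canonicalElement = ∑ i, x i ⊗ₜ[S] y i := by
  apply hB.tensorEquivEnd.injective
  rw [hB.tensorEquivEnd_canonical]
  ext v
  simp [hB.tensorEquivEnd_tmul, hd.left]

end IsDualFamily

end DualFamilies

section CliffordSums

variable {S : Type*} [CommRing S] [Algebra ℂ S] {M : Type*} [AddCommGroup M] [Module S M]
  {ι : Type*} [Fintype ι] {B : BilinForm S M} {a b : ι → M}
  {A : Type*} [Ring A] [Algebra S A] {g : M →ₗ[S] A}

lemma nsmul_cancel {N : Type*} [AddCommGroup N] [Module S N] (n : ℕ) (hn : n ≠ 0) {u v : N}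
    (h : n • u = n • v) : u = v := by
  have e : algebraMap ℂ S ((n : ℂ)⁻¹) * (n : S) = 1 := by
    rw [← map_natCast (algebraMap ℂ S) n, ← map_mul, inv_mul_cancel₀ (by exact_mod_cast hn),
      map_one]
  rw [← Nat.cast_smul_eq_nsmul S, ← Nat.cast_smul_eq_nsmul S] at h
  rw [← one_smul S u, ← one_smul S v, ← e, mul_smul, mul_smul, h]

omit [Algebra ℂ S] in
/-- For a skew operator the order of the factors in `∑ₗ γ(T aₗ) γ(bₗ)` matters only by a sign,
since its trace vanishes. -/
lemma sum_clifford_skew (hd : IsDualFamily B a b) (T : M →ₗ[S] M)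
    (hT : ∀ u v, B (T u) v = - B u (T v)) :
    ∑ l, g (b l) * g (T (a l)) = - ∑ l, g (T (a l)) * g (b l) := by
  let f : M →ₗ[S] M →ₗ[S] A := (LinearMap.mul S A).compl₁₂ g g
  have h1 : ∑ l, g (T (a l)) * g (b l) = ∑ l, g (a l) * g (-T (b l)) :=
    hd.sum_adjoint f (T' := fun v => -T v) (by simpa using hT)
  have h2 : ∑ l, g (a l) * g (T (b l)) = ∑ l, g (b l) * g (T (a l)) :=
    hd.sum_swap (f.compl₂ T)
  rw [h1, ← h2]
  simp

variable (hg : ∀ u v, g u * g v + g v * g u = algebraMap S A (B u v))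
include hg

omit [Algebra ℂ S] in
/-- `∑ₗ γ(C aₗ) γ(bₗ)` is half the trace of a self-adjoint operator `C`. -/
lemma sum_clifford_selfAdjoint (hd : IsDualFamily B a b) (C : M →ₗ[S] M)
    (hC : ∀ u v, B (C u) v = B u (C v)) :
    2 • ∑ l, g (C (a l)) * g (b l) = algebraMap S A (∑ l, B (C (a l)) (b l)) := by
  let f : M →ₗ[S] M →ₗ[S] A := (LinearMap.mul S A).compl₁₂ g g
  have h1 : ∑ l, g (C (a l)) * g (b l) = ∑ l, g (a l) * g (C (b l)) := hd.sum_adjoint f hC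
  have h2 : ∑ l, g (a l) * g (C (b l)) = ∑ l, g (b l) * g (C (a l)) :=
    hd.sum_swap (f.compl₂ C)
  rw [two_nsmul]
  nth_rewrite 2 [h1]
  rw [h2, ← Finset.sum_add_distrib, map_sum]
  exact Finset.sum_congr rfl fun l _ => hg _ _

/-- The cubic identity behind Parthasarathy's computation: for a Lie triple product `t`, the sum
`∑ γ([[aⱼ, aₗ], aₘ]) γ(bₘ) γ(bⱼ) γ(bₗ)` has no component of degree four, by the Jacobi identity. -/
lemma sum_clifford_triple (hd : IsDualFamily B a b) (t : M →ₗ[S] M →ₗ[S] M →ₗ[S] M)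
    (hskew : ∀ u v w, t u v w = - t v u w)
    (hjac : ∀ u v w, t u v w + t v w u + t w u v = 0) :
    ∑ j, ∑ l, ∑ m, g (t (a j) (a l) (a m)) * (g (b m) * (g (b j) * g (b l))) =
      - ∑ l, ∑ j, g (t (a l) (b j) (a j)) * g (b l) := by
  set F : ι → ι → ι → A := fun j l m =>
    g (t (a j) (a l) (a m)) * (g (b m) * (g (b j) * g (b l))) with hF
  set X := ∑ j, ∑ l, ∑ m, F j l m with hX
  set Y := ∑ l, ∑ j, g (t (a l) (b j) (a j)) * g (b l) with hY
  have hX1 : X = ∑ j, ∑ l, ∑ m, F l m j := by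
    rw [hX, Finset.sum_comm' (t' := Finset.univ) (s' := fun _ => Finset.univ) (by simp)]
    rw [Finset.sum_comm]
    conv_rhs => rw [Finset.sum_comm]; enter [2, l]; rw [Finset.sum_comm]
  have hX2 : X = ∑ j, ∑ l, ∑ m, F m j l := by
    rw [hX]
    conv_rhs => enter [2, j]; rw [Finset.sum_comm]
    rw [Finset.sum_comm]
  have e1 : ∑ j, ∑ l, ∑ m, B (b l) (b m) • (g (t (a l) (a m) (a j)) * g (b j)) = 0 := by
    refine Finset.sum_eq_zero fun j _ => ?_
    have h1 : ∀ l, ∑ m, B (b l) (b m) • (g (t (a l) (a m) (a j)) * g (b j)) =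
        g (t (a l) (b l) (a j)) * g (b j) := fun l =>
      hd.swap.sum_smul' (LinearMap.mulRight S (g (b j)) ∘ₗ g ∘ₗ (t (a l)).flip (a j)) (b l)
    simp only [h1]
    let f : M →ₗ[S] M →ₗ[S] A :=
      t.compr₂ (LinearMap.mulRight S (g (b j)) ∘ₗ g ∘ₗ LinearMap.applyₗ (a j))
    have h2 : ∑ l, g (t (a l) (b l) (a j)) * g (b j) = ∑ l, g (t (b l) (a l) (a j)) * g (b j) :=
      hd.sum_swap f
    apply nsmul_cancel (S := S) 2 two_ne_zero
    rw [two_nsmul, smul_zero]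
    nth_rewrite 2 [h2]
    rw [← Finset.sum_add_distrib]
    refine Finset.sum_eq_zero fun l _ => ?_
    rw [hskew (b l)]
    simp
  have e2 : ∑ j, ∑ l, ∑ m, B (b j) (b m) • (g (t (a l) (a m) (a j)) * g (b l)) = Y := by
    rw [hY, Finset.sum_comm]
    refine Finset.sum_congr rfl fun l _ => Finset.sum_congr rfl fun j _ => ?_
    exact hd.swap.sum_smul' (LinearMap.mulRight S (g (b l)) ∘ₗ g ∘ₗ (t (a l)).flip (a j)) (b j)
  have e3 : ∑ j, ∑ l, ∑ m, B (b l) (b m) • (g (t (a m) (a j) (a l)) * g (b j)) = - Y := by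
    rw [hY, ← Finset.sum_neg_distrib]
    refine Finset.sum_congr rfl fun j _ => ?_
    have h1 : ∀ l, ∑ m, B (b l) (b m) • (g (t (a m) (a j) (a l)) * g (b j)) =
        g (t (b l) (a j) (a l)) * g (b j) := fun l =>
      hd.swap.sum_smul' (LinearMap.mulRight S (g (b j)) ∘ₗ g ∘ₗ (t.flip (a j)).flip (a l)) (b l)
    rw [← Finset.sum_neg_distrib]
    refine Finset.sum_congr rfl fun l _ => ?_
    rw [h1, hskew]
    simp
  have e4 : ∑ j, ∑ l, ∑ m, B (b l) (b j) • (g (t (a m) (a j) (a l)) * g (b m)) = Y := by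
    have h1 : ∀ l m, ∑ j, B (b l) (b j) • (g (t (a m) (a j) (a l)) * g (b m)) =
        g (t (a m) (b l) (a l)) * g (b m) := fun l m =>
      hd.swap.sum_smul' (LinearMap.mulRight S (g (b m)) ∘ₗ g ∘ₗ (t (a m)).flip (a l)) (b l)
    rw [Finset.sum_comm]
    conv_lhs => enter [2, l]; rw [Finset.sum_comm]; enter [2, m]; rw [h1]
    rw [Finset.sum_comm]
  -- Average over the cyclic relabelings of `(j, l, m)`: the cubic Clifford parts cancel by the
  -- Jacobi identity, and only the contractions `e1`, ..., `e4` remain.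
  have key : ∀ j l m, F j l m + F l m j + F m j l =
      B (b l) (b m) • (g (t (a l) (a m) (a j)) * g (b j)) -
      B (b j) (b m) • (g (t (a l) (a m) (a j)) * g (b l)) +
      B (b l) (b m) • (g (t (a m) (a j) (a l)) * g (b j)) -
      B (b l) (b j) • (g (t (a m) (a j) (a l)) * g (b m)) := by
    intro j l m
    have hj := congrArg g (hjac (a j) (a l) (a m))
    rw [map_add, map_add, map_zero] at hj
    have hj' : g (t (a j) (a l) (a m)) =
        - g (t (a l) (a m) (a j)) - g (t (a m) (a j) (a l)) := by
      rw [← sub_eq_zero, ← hj]; abel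
    have hl : ∀ (s : S) (u : A), s • u = u * algebraMap S A s := fun s u => by
      rw [Algebra.smul_def, Algebra.commutes]
    have c1 : g (b j) * (g (b l) * g (b m)) = g (b m) * (g (b j) * g (b l)) +
        B (b l) (b m) • g (b j) - B (b j) (b m) • g (b l) := by
      rw [hl (B (b l) (b m)), Algebra.smul_def, ← hg, ← hg]
      noncomm_ring
    have c2 : g (b l) * (g (b m) * g (b j)) = g (b m) * (g (b j) * g (b l)) +
        B (b l) (b m) • g (b j) - B (b l) (b j) • g (b m) := by
      rw [hl (B (b l) (b j)), Algebra.smul_def, ← hg, ← hg]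
      noncomm_ring
    simp only [hF]
    rw [hj', c1, c2]
    simp only [mul_add, mul_sub, sub_mul, neg_mul, mul_smul_comm]
    abel
  apply nsmul_cancel (S := S) 3 three_ne_zero
  have h3 : 3 • X = X + (∑ j, ∑ l, ∑ m, F l m j) + ∑ j, ∑ l, ∑ m, F m j l := by
    rw [← hX1, ← hX2]; abel
  rw [h3, hX]
  simp only [← Finset.sum_add_distrib]
  simp only [key, Finset.sum_add_distrib, Finset.sum_sub_distrib]
  rw [e1, e2, e3, e4]
  abel

omit [Algebra ℂ S] in
/-- The square of `D = ∑ⱼ u(aⱼ) γ(bⱼ)`, when the `u(aⱼ)` commute with the `γ(bₗ)`. -/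
lemma two_nsmul_dirac_sq (hd : IsDualFamily B a b) {u : M →ₗ[S] A}
    (hug : ∀ x y, u x * g y = g y * u x) :
    2 • (∑ j, u (a j) * g (b j)) ^ 2 = ∑ j, u (a j) * u (b j) +
      ∑ j, ∑ l, (u (a j) * u (a l) - u (a l) * u (a j)) * (g (b j) * g (b l)) := by
  have e1 : (∑ j, u (a j) * g (b j)) ^ 2 =
      ∑ j, ∑ l, u (a j) * u (a l) * (g (b j) * g (b l)) := by
    rw [sq, Finset.sum_mul_sum]
    refine Finset.sum_congr rfl fun j _ => Finset.sum_congr rfl fun l _ => ?_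
    rw [mul_assoc, ← mul_assoc (g (b j)), ← hug (a l) (b j)]
    noncomm_ring
  have e2 : ∑ j, u (a j) * u (b j) =
      ∑ j, ∑ l, u (a j) * u (a l) * (g (b j) * g (b l) + g (b l) * g (b j)) := by
    refine Finset.sum_congr rfl fun j _ => ?_
    refine (hd.swap.sum_smul' (LinearMap.mulLeft S (u (a j)) ∘ₗ u) (b j)).symm.trans ?_
    refine Finset.sum_congr rfl fun l _ => ?_
    rw [hg, ← Algebra.commutes, ← Algebra.smul_def]
    rfl
  have e3 : ∑ j, ∑ l, u (a l) * u (a j) * (g (b j) * g (b l)) =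
      ∑ j, ∑ l, u (a j) * u (a l) * (g (b l) * g (b j)) := Finset.sum_comm
  simp only [sub_mul, Finset.sum_sub_distrib]
  rw [e1, e2, e3, two_nsmul]
  simp only [mul_add, Finset.sum_add_distrib]
  abel

end CliffordSums

section Moment

variable {S : Type*} [CommRing S] [Algebra ℂ S] {M : Type*} [AddCommGroup M] [Module S M]
  {ι : Type*} [Fintype ι] {B : BilinForm S M} {a b : ι → M}
  {A : Type*} [Ring A] [Algebra S A] {g : M →ₗ[S] A}
  {K : Type*} [AddCommGroup K] [Module S K] {κ : Type*} [Fintype κ] {Bk : BilinForm S K}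
  {x y : κ → K}
  {act : K →ₗ[S] Module.End S M} {μ : M →ₗ[S] M →ₗ[S] K} {c : S}

variable (hg : ∀ u v, g u * g v + g v * g u = algebraMap S A (B u v))
  (hact : ∀ k u v, B (act k u) v = - B u (act k v))
  (hμ : ∀ k u v, Bk k (μ u v) = c * B (act k u) v)
include hact hμ

omit [Algebra ℂ S] in
/-- If `μ` is adjoint to the action of `K` by skew operators, then for any linear `f` the sum of
`f([aⱼ, aₗ]) γ(bⱼ) γ(bₗ)` is a sum over dual families of `K`. -/
lemma sum_moment_clifford (hd : IsDualFamily B a b) (hk : IsDualFamily Bk x y) (f : K →ₗ[S] A) :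
    ∑ j, ∑ l, f (μ (a j) (a l)) * (g (b j) * g (b l)) =
      - c • ∑ i, f (y i) * ∑ l, g (act (x i) (a l)) * g (b l) := by
  have h1 : ∀ j l, f (μ (a j) (a l)) * (g (b j) * g (b l)) =
      ∑ i, c • B (act (x i) (a j)) (a l) • (f (y i) * (g (b j) * g (b l))) := by
    intro j l
    rw [← hk.sum_smul f, Finset.sum_mul]
    refine Finset.sum_congr rfl fun i _ => ?_
    rw [hμ, mul_smul, smul_mul_assoc, smul_mul_assoc]
  simp only [h1]
  have h2 : ∀ i j, ∑ l, c • B (act (x i) (a j)) (a l) • (f (y i) * (g (b j) * g (b l))) =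
      c • (f (y i) * (g (b j) * g (act (x i) (a j)))) := by
    intro i j
    rw [← Finset.smul_sum]
    congr 1
    exact hd.sum_smul' (LinearMap.mulLeft S (f (y i)) ∘ₗ LinearMap.mulLeft S (g (b j)) ∘ₗ g) _
  conv_lhs => enter [2, j]; rw [Finset.sum_comm]; enter [2, i]; rw [h2]
  rw [Finset.sum_comm, neg_smul, ← smul_neg, ← Finset.sum_neg_distrib, Finset.smul_sum]
  refine Finset.sum_congr rfl fun i _ => ?_
  rw [← Finset.smul_sum, ← Finset.mul_sum, sum_clifford_skew hd _ (hact (x i)), mul_neg]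

include hg in
/-- The image of the Casimir element of `K` in the Clifford algebra is the scalar
`(1/8) tr_M(Ω_K)`, here up to the factor `c`. -/
lemma sum_spin_casimir (hd : IsDualFamily B a b) (hk : IsDualFamily Bk x y)
    (hskew : ∀ u v, μ u v = - μ v u)
    (hjac : ∀ u v w, act (μ u v) w + act (μ v w) u + act (μ w u) v = 0) :
    c • (2 • ∑ i, (∑ l, g (act (x i) (a l)) * g (b l)) * ∑ l, g (act (y i) (a l)) * g (b l)) =
      c • algebraMap S A (∑ i, ∑ l, B (act (x i) (act (y i) (a l))) (b l)) := by
  let t : M →ₗ[S] M →ₗ[S] M →ₗ[S] M := μ.compr₂ act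
  let q : K →ₗ[S] A := ∑ l, LinearMap.mulRight S (g (b l)) ∘ₗ g ∘ₗ LinearMap.applyₗ (a l) ∘ₗ act
  have hq : ∀ k, q k = ∑ l, g (act k (a l)) * g (b l) := fun k => by simp [q]
  let C : M →ₗ[S] M := ∑ i, act (x i) ∘ₗ act (y i)
  have hC : ∀ v, C v = ∑ i, act (x i) (act (y i) v) := fun v => by simp [C]
  have hC' : ∀ v, C v = ∑ i, act (y i) (act (x i) v) := fun v => by
    rw [hC]
    let f : K →ₗ[S] K →ₗ[S] M :=
      (LinearMap.mul S (Module.End S M)).compl₁₂ act act |>.compr₂ (LinearMap.applyₗ v)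
    exact hk.sum_swap f
  have hCs : ∀ u v, B (C u) v = B u (C v) := by
    intro u v
    rw [hC, hC', map_sum, LinearMap.sum_apply, map_sum]
    refine Finset.sum_congr rfl fun i _ => ?_
    rw [hact, hact, neg_neg]
  have h1 := sum_clifford_triple hg hd t (fun u v w => by simp [t, hskew u v])
    (fun u v w => by simpa [t] using hjac u v w)
  have h2 : ∀ j l, ∑ m, g (t (a j) (a l) (a m)) * (g (b m) * (g (b j) * g (b l))) =
      q (μ (a j) (a l)) * (g (b j) * g (b l)) := by
    intro j l
    rw [hq, Finset.sum_mul]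
    exact Finset.sum_congr rfl fun m _ => (mul_assoc _ _ _).symm
  simp only [h2] at h1
  rw [sum_moment_clifford hact hμ hd hk q] at h1
  have h3 : ∀ v, ∑ j, t v (b j) (a j) = c • C v := by
    intro v
    have h4 : ∀ j, t v (b j) (a j) = ∑ i, c • B (act (x i) v) (b j) • act (y i) (a j) := by
      intro j
      change act (μ v (b j)) (a j) = _
      rw [← hk.left (μ v (b j)), map_sum, LinearMap.sum_apply]
      refine Finset.sum_congr rfl fun i _ => ?_
      rw [hμ, map_smul, mul_smul]
      rfl
    simp only [h4]
    rw [Finset.sum_comm, hC', Finset.smul_sum]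
    refine Finset.sum_congr rfl fun i _ => ?_
    rw [← Finset.smul_sum, hd.swap.sum_smul']
  have h5 : ∑ l, ∑ j, g (t (a l) (b j) (a j)) * g (b l) = c • ∑ l, g (C (a l)) * g (b l) := by
    rw [Finset.smul_sum]
    refine Finset.sum_congr rfl fun l _ => ?_
    rw [← Finset.sum_mul, ← map_sum, h3, map_smul, smul_mul_assoc]
  rw [h5, neg_smul, neg_inj] at h1
  have h6 : ∑ i, q (y i) * ∑ l, g (act (x i) (a l)) * g (b l) =
      ∑ i, (∑ l, g (act (x i) (a l)) * g (b l)) * ∑ l, g (act (y i) (a l)) * g (b l) := by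
    simp only [← hq]
    exact (hk.sum_swap ((LinearMap.mul S A).compl₁₂ q q)).symm
  rw [h6] at h1
  rw [smul_comm, h1, smul_comm, sum_clifford_selfAdjoint hg hd C hCs, Finset.sum_comm]
  simp [hC]

include hg in
/-- The formula for the square of the Dirac operator in an arbitrary algebra: `uM` and `uK` play
the roles of the inclusions of `M` and `K` in an enveloping algebra, and `αK` that of the spin
map of `K`. -/
lemma two_smul_dirac_sq_of_moment (hd : IsDualFamily B a b) (hk : IsDualFamily Bk x y)
    (hskew : ∀ u v, μ u v = - μ v u)
    (hjac : ∀ u v w, act (μ u v) w + act (μ v w) u + act (μ w u) v = 0)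
    {uM : M →ₗ[S] A} {uK αK : K →ₗ[S] A}
    (hug : ∀ u v, uM u * g v = g v * uM u) (huα : ∀ u v, uK u * αK v = αK v * uK u)
    (hbr : ∀ u v, uM u * uM v - uM v * uM u = uK (μ u v))
    (hα : ∀ k, ∑ j, g (act k (a j)) * g (b j) = 2 • αK k)
    {s : S} (hs : 8 * s = ∑ i, ∑ l, B (act (x i) (act (y i) (a l))) (b l)) :
    (2 : S) • (∑ j, uM (a j) * g (b j)) ^ 2 =
      (c • ∑ i, uK (x i) * uK (y i) + ∑ j, uM (a j) * uM (b j)) -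
        c • ∑ i, (uK (x i) + αK (x i)) * (uK (y i) + αK (y i)) + (c * s) • 1 := by
  have hsq := two_nsmul_dirac_sq hg hd hug
  have hmom := sum_moment_clifford hact hμ hd hk uK (g := g)
  have hcas := sum_spin_casimir hg hact hμ hd hk hskew hjac
  simp only [hbr, hα] at hsq hmom hcas
  have hswap : ∑ i, uK (y i) * αK (x i) = ∑ i, uK (x i) * αK (y i) :=
    (hk.sum_swap ((LinearMap.mul S A).compl₁₂ uK αK)).symm
  have hswap' : ∑ i, αK (x i) * uK (y i) = ∑ i, uK (x i) * αK (y i) := by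
    rw [← hswap]
    exact Finset.sum_congr rfl fun i _ => (huα _ _).symm
  have hcas' : c • ∑ i, αK (x i) * αK (y i) = (c * s) • (1 : A) := by
    apply nsmul_cancel (S := S) 8 (by norm_num)
    have e : 8 • (c * s) = c * (8 * s) := by
      rw [nsmul_eq_mul]; push_cast; ring
    rw [← smul_assoc 8 (c * s), e, mul_smul, ← Algebra.algebraMap_eq_smul_one, hs]
    refine Eq.trans ?_ hcas
    simp only [smul_mul_smul_comm, ← Finset.smul_sum, smul_smul]
    rw [smul_comm]
    norm_num
  rw [two_smul, ← two_nsmul, hsq, hmom, ← hcas']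
  simp only [add_mul, mul_add, Finset.sum_add_distrib, hswap,
    hswap', smul_add, neg_smul, two_nsmul]
  abel

end Moment

/-! ### Existence and base change of dual families -/

section Existence

lemma exists_isDualFamily {V : Type*} [AddCommGroup V] [Module ℂ V] [FiniteDimensional ℂ V]
    {B : BilinForm ℂ V} (hs : ∀ u v, B u v = B v u) (hB : Unimodular B) :
    ∃ (n : ℕ) (x y : Fin n → V), IsDualFamily B x y := by
  classical
  let b := Module.finBasis ℂ V
  let b' := b.dualBasis.map hB.toDual.symm
  have hbb : ∀ i v, B (b' i) v = b.repr v i := by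
    intro i v
    have : B (b' i) = b.dualBasis i := hB.toDual.apply_symm_apply _
    rw [this]
    simp
  exact ⟨_, b', b, IsDualFamily.of_left hs hB.injective fun v => by simp only [hbb, b.sum_repr]⟩

end Existence

section BaseChange

variable (R : Type*) [CommRing R] [Algebra ℂ R] {V : Type*} [AddCommGroup V] [Module ℂ V]
  {ι : Type*} [Fintype ι]

lemma IsDualFamily.sum_baseChange {B : BilinForm ℂ V} {N : Submodule ℂ V} {x y : ι → N}
    (hd : IsDualFamily (pullForm B N.subtype) x y) (v : R ⊗[ℂ] V) (hv : v ∈ N.baseChange R) :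
    ∑ i, B.baseChange R (1 ⊗ₜ (x i : V)) v • (1 : R) ⊗ₜ[ℂ] (y i : V) = v := by
  rw [Submodule.baseChange_eq_span] at hv
  induction hv using Submodule.span_induction with
  | mem v hv =>
    obtain ⟨w, hw, rfl⟩ := hv
    have h := congrArg (fun z : N => (1 : R) ⊗ₜ[ℂ] (z : V)) (hd.left ⟨w, hw⟩)
    simp only [AddSubmonoidClass.coe_finsetSum, SetLike.val_smul, TensorProduct.tmul_sum] at h
    rw [TensorProduct.mk_apply]
    conv_rhs => rw [← h]
    refine Finset.sum_congr rfl fun i _ => ?_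
    simp [pullForm, TensorProduct.smul_tmul']
  | zero => simp
  | add u w _ _ hu hw => simp only [map_add, add_smul, Finset.sum_add_distrib, hu, hw]
  | smul c u _ hu => simp only [map_smul, smul_eq_mul, mul_smul, ← Finset.smul_sum, hu]

end BaseChange

section Trace

variable {L : Type*} [LieRing L] [LieAlgebra ℂ L] {B : BilinForm ℂ L}

lemma form_lie_skew (hi : ∀ x y z, B ⁅x, y⁆ z = B x ⁅y, z⁆) (x y z : L) :
    B ⁅x, y⁆ z = - B y ⁅x, z⁆ := by
  rw [← lie_skew, map_neg, LinearMap.neg_apply, hi]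

variable (B) in
/-- The trace of the Casimir element in the adjoint representation, computed in dual families. -/
def casimirTrace {σ : Type*} [Fintype σ] (z w : σ → L) : ℂ :=
  ∑ i, ∑ j, B ⁅z i, ⁅w i, z j⁆⁆ (w j)

end Trace

/-! ### The decomposition of the trace of the Casimir element -/

namespace QuadraticPair

attribute [local instance 2000] LieRing.ofAssociativeRing

variable {𝔤 : Type*} [LieRing 𝔤] [LieAlgebra ℂ 𝔤] (X : QuadraticPair 𝔤)

/-- The restriction of `β` to `𝔨`. -/
abbrev formK : BilinForm ℂ X.k := pullForm X.β X.k.toSubmodule.subtype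

/-- The restriction of `β` to `𝔭`. -/
abbrev formP : BilinForm ℂ X.p := pullForm X.β X.p.subtype

lemma formK_symm (u v : X.k) : X.formK u v = X.formK v u := X.β_symm _ _

lemma formP_symm (u v : X.p) : X.formP u v = X.formP v u := X.β_symm _ _

lemma formK_unimodular [FiniteDimensional ℂ 𝔤] : Unimodular X.formK :=
  unimodular_restrict (unimodular_of_nondegenerate X.β_nondegenerate) (X.proj 1)
    (X.proj_selfAdjoint 1) X.proj_k X.proj_mem_k

lemma formP_unimodular [FiniteDimensional ℂ 𝔤] : Unimodular X.formP :=
  unimodular_restrict (unimodular_of_nondegenerate X.β_nondegenerate) (X.proj (-1))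
    (X.proj_selfAdjoint (-1)) X.proj_p X.proj_mem_p

lemma proj_add_proj (v : 𝔤) : X.proj 1 v + X.proj (-1) v = v := by
  rw [proj_apply, proj_apply, ← smul_add, one_smul, neg_one_smul, add_add_add_comm, add_neg_cancel,
    add_zero, ← two_smul ℂ, smul_smul]
  simp

variable {κ ι : Type*} [Fintype κ] [Fintype ι] {x y : κ → X.k} {a b : ι → X.p}

/-- Dual families of `𝔨` and `𝔭` form together a dual family of `𝔤`. -/
lemma isDualFamily_sum [FiniteDimensional ℂ 𝔤] (hk : IsDualFamily X.formK x y)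
    (hp : IsDualFamily X.formP a b) :
    IsDualFamily X.β (Sum.elim (fun i => (x i : 𝔤)) (fun j => (a j : 𝔤)))
      (Sum.elim (fun i => (y i : 𝔤)) (fun j => (b j : 𝔤))) := by
  refine IsDualFamily.of_left X.β_symm
    (unimodular_of_nondegenerate X.β_nondegenerate).injective fun v => ?_
  rw [Fintype.sum_sum_type]
  simp only [Sum.elim_inl, Sum.elim_inr]
  have e1 : ∀ z : X.k, X.β z v = X.formK z ⟨X.proj 1 v, X.proj_mem_k v⟩ := fun z => by
    change _ = X.β z (X.proj 1 v)
    rw [← X.proj_selfAdjoint, X.proj_k _ z.2]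
  have e2 : ∀ z : X.p, X.β z v = X.formP z ⟨X.proj (-1) v, X.proj_mem_p v⟩ := fun z => by
    change _ = X.β z (X.proj (-1) v)
    rw [← X.proj_selfAdjoint, X.proj_p _ z.2]
  have h1 := hk.sum_smul X.k.toSubmodule.subtype ⟨X.proj 1 v, X.proj_mem_k v⟩
  have h2 := hp.sum_smul X.p.subtype ⟨X.proj (-1) v, X.proj_mem_p v⟩
  simp only [← e1, ← e2] at h1 h2
  conv_rhs => rw [← X.proj_add_proj v]
  exact congrArg₂ (· + ·) h1 h2

/-- The trace of the Casimir element of `𝔨` on `𝔭`, computed in dual families. -/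
def casimirTraceP (x y : κ → X.k) (a b : ι → X.p) : ℂ :=
  ∑ i, ∑ j, X.β ⁅(x i : 𝔤), ⁅(y i : 𝔤), (a j : 𝔤)⁆⁆ (b j)

lemma β_lie_skew (u v w : 𝔤) : X.β ⁅u, v⁆ w = - X.β v ⁅u, w⁆ :=
  form_lie_skew X.β_lie u v w

/-- The trace of the Casimir element of `𝔤` in the adjoint representation: of its four blocks one
is the trace for `𝔨`, and the other three coincide. -/
lemma casimirTrace_sum (hk : IsDualFamily X.formK x y) (hp : IsDualFamily X.formP a b) :
    casimirTrace X.β (Sum.elim (fun i => (x i : 𝔤)) (fun j => (a j : 𝔤)))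
      (Sum.elim (fun i => (y i : 𝔤)) (fun j => (b j : 𝔤))) =
    casimirTrace X.formK x y + 3 * X.casimirTraceP x y a b := by
  simp only [casimirTrace, Fintype.sum_sum_type, Sum.elim_inl, Sum.elim_inr,
    Finset.sum_add_distrib]
  have h1 : ∑ j, ∑ i, X.β ⁅(a j : 𝔤), ⁅(b j : 𝔤), (x i : 𝔤)⁆⁆ (y i) =
      X.casimirTraceP x y a b := by
    rw [Finset.sum_comm, casimirTraceP]
    refine Finset.sum_congr rfl fun i _ => Finset.sum_congr rfl fun j _ => ?_
    rw [X.β_lie_skew (a j), X.β_lie_skew (x i), ← lie_skew (b j : 𝔤) (x i),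
      ← lie_skew (a j : 𝔤) (y i), map_neg, map_neg, LinearMap.neg_apply, neg_neg, X.β_symm]
  have h2 : ∑ j, ∑ l, X.β ⁅(a j : 𝔤), ⁅(b j : 𝔤), (a l : 𝔤)⁆⁆ (b l) =
      X.casimirTraceP x y a b := by
    have e1 : ∀ j l, X.β ⁅(a j : 𝔤), ⁅(b j : 𝔤), (a l : 𝔤)⁆⁆ (b l) =
        - ∑ i, X.β ⁅(x i : 𝔤), (b j : 𝔤)⁆ (a l) * X.β ⁅(y i : 𝔤), (a j : 𝔤)⁆ (b l) := by
      intro j l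
      have := hk.sum_smul ((X.β.flip ⁅(a j : 𝔤), (b l : 𝔤)⁆) ∘ₗ X.k.toSubmodule.subtype)
        ⟨⁅(b j : 𝔤), (a l : 𝔤)⁆, X.lie_pp (b j).2 (a l).2⟩
      change _ = X.β ⁅(b j : 𝔤), (a l : 𝔤)⁆ ⁅(a j : 𝔤), (b l : 𝔤)⁆ at this
      rw [X.β_lie_skew, ← this]
      congr 1
      refine Finset.sum_congr rfl fun i _ => ?_
      rw [X.β_lie, X.β_lie]
      rfl
    simp only [e1, Finset.sum_neg_distrib]
    rw [casimirTraceP, ← Finset.sum_neg_distrib]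
    conv_lhs => enter [2, j]; rw [Finset.sum_comm]
    rw [Finset.sum_neg_distrib, Finset.sum_comm, ← Finset.sum_neg_distrib]
    refine Finset.sum_congr rfl fun i _ => ?_
    rw [← Finset.sum_neg_distrib]
    refine Finset.sum_congr rfl fun j _ => ?_
    have := hp.swap.sum_smul (X.β ⁅(x i : 𝔤), (b j : 𝔤)⁆ ∘ₗ X.p.subtype)
      ⟨⁅(y i : 𝔤), (a j : 𝔤)⁆, X.lie_kp (y i).2 (a j).2⟩
    change _ = X.β ⁅(x i : 𝔤), (b j : 𝔤)⁆ ⁅(y i : 𝔤), (a j : 𝔤)⁆ at this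
    rw [X.β_lie_skew, X.β_symm, ← this]
    congr 1
    refine Finset.sum_congr rfl fun l _ => ?_
    rw [mul_comm, X.β_symm]
    rfl
  rw [h1, h2]
  have h3 : ∑ i, ∑ j, X.β ⁅(x i : 𝔤), ⁅(y i : 𝔤), (x j : 𝔤)⁆⁆ (y j) =
      ∑ i, ∑ j, X.formK ⁅x i, ⁅y i, x j⁆⁆ (y j) := rfl
  rw [h3]
  simp only [casimirTraceP]
  ring

end QuadraticPair

/-! ### The family of Dirac operators -/

namespace QuadraticPair

attribute [local instance 2000] LieRing.ofAssociativeRing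

variable {𝔤 : Type*} [LieRing 𝔤] [LieAlgebra ℂ 𝔤] (X : QuadraticPair 𝔤)
  {κ ι : Type*} [Fintype κ] [Fintype ι] {x y : κ → X.k} {a b : ι → X.p}
  {R : Type*} [CommRing R] [Algebra ℂ R] {r : R}

/-- The element `1 ⊗ v` of `R ⊗ 𝔨`. -/
def liftK (R : Type*) [CommRing R] [Algebra ℂ R] (v : X.k) : X.kFam R :=
  ⟨1 ⊗ₜ (v : 𝔤), Submodule.tmul_mem_baseChange_of_mem _ v.2⟩

/-- The element `r ⊗ v` of `⟨r⟩ ⊗ 𝔭`. -/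
def liftP (r : R) (v : X.p) : X.pFam r :=
  ⟨r • (1 : R) ⊗ₜ (v : 𝔤), X.mem_pFam.2 ⟨_, Submodule.tmul_mem_baseChange_of_mem _ v.2, rfl⟩⟩

lemma βR_tmul (s t : R) (u v : 𝔤) :
    X.βR R (s ⊗ₜ u) (t ⊗ₜ v) = s * t * algebraMap ℂ R (X.β u v) := by
  simp [βR, Algebra.smul_def, mul_comm]

lemma isDualFamily_liftK [FiniteDimensional ℂ 𝔤] (hk : IsDualFamily X.formK x y) :
    IsDualFamily (X.βk R) (X.liftK R ∘ x) (X.liftK R ∘ y) := by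
  refine IsDualFamily.of_left (fun u v => baseChange_symm R X.β_symm _ _)
    X.βk_unimodular.injective fun v => Subtype.ext ?_
  have h := hk.sum_baseChange R (v : R ⊗[ℂ] 𝔤) v.2
  conv_rhs => rw [← h]
  rw [AddSubmonoidClass.coe_finsetSum]
  rfl

variable [IsDomain R]

lemma βr_Tr (hr : r ≠ 0) (u v : X.p.baseChange R) :
    X.βr hr (X.Tr hr u) (X.Tr hr v) = X.βR R u v := by
  simp [βr, pullForm]

lemma βr_liftP (hr : r ≠ 0) (u v : X.p) :
    X.βr hr (X.liftP r u) (X.liftP r v) = algebraMap ℂ R (X.β u v) := by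
  have := X.βr_Tr hr ⟨1 ⊗ₜ (u : 𝔤), Submodule.tmul_mem_baseChange_of_mem _ u.2⟩
    ⟨1 ⊗ₜ (v : 𝔤), Submodule.tmul_mem_baseChange_of_mem _ v.2⟩
  rw [βR_tmul, one_mul, one_mul] at this
  exact this

lemma isDualFamily_liftP [FiniteDimensional ℂ 𝔤] (hr : r ≠ 0) (hp : IsDualFamily X.formP a b) :
    IsDualFamily (X.βr hr) (X.liftP r ∘ a) (X.liftP r ∘ b) := by
  refine IsDualFamily.of_left (X.βr_symm hr) (X.βr_unimodular hr).injective fun v => ?_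
  obtain ⟨v, rfl⟩ := (X.Tr hr).surjective v
  have h := hp.sum_baseChange R (v : R ⊗[ℂ] 𝔤) v.2
  have e : ∀ u : X.p, X.liftP r u =
      X.Tr hr ⟨1 ⊗ₜ (u : 𝔤), Submodule.tmul_mem_baseChange_of_mem _ u.2⟩ := fun u => rfl
  simp only [Function.comp_apply, e, βr_Tr, ← map_smul, ← map_sum]
  congr 1
  refine Subtype.ext ?_
  conv_rhs => rw [← h]
  rw [AddSubmonoidClass.coe_finsetSum]
  rfl

/-- The action of `R ⊗ 𝔨` on `⟨r⟩ ⊗ 𝔭` as a linear map to the endomorphisms. -/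
def adLin (hr : r ≠ 0) : X.kFam R →ₗ[R] Module.End R (X.pFam r) :=
  (skewAdjointLieSubalgebra (X.βr hr)).toSubmodule.subtype ∘ₗ (X.ad hr : X.kFam R →ₗ[R] _)

lemma coe_adLin (hr : r ≠ 0) (k : X.kFam R) (u : X.pFam r) :
    (X.adLin hr k u : R ⊗[ℂ] 𝔤) = ⁅(k : R ⊗[ℂ] 𝔤), (u : R ⊗[ℂ] 𝔤)⁆ := rfl

omit [IsDomain R] in
variable (r) in
/-- The bracket of two elements of `⟨r⟩ ⊗ 𝔭`, with values in `R ⊗ 𝔨`. -/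
def bracketP : X.pFam r →ₗ[R] X.pFam r →ₗ[R] X.kFam R :=
  LinearMap.mk₂ R (fun u v => ⟨⁅(u : R ⊗[ℂ] 𝔤), (v : R ⊗[ℂ] 𝔤)⁆, X.lie_pFam_pFam u.2 v.2⟩)
    (fun _ _ _ => Subtype.ext (add_lie _ _ _)) (fun _ _ _ => Subtype.ext (smul_lie _ _ _))
    (fun _ _ _ => Subtype.ext (lie_add _ _ _)) (fun _ _ _ => Subtype.ext (lie_smul _ _ _))

omit [IsDomain R] in
lemma coe_bracketP (u v : X.pFam r) :
    (X.bracketP r u v : R ⊗[ℂ] 𝔤) = ⁅(u : R ⊗[ℂ] 𝔤), (v : R ⊗[ℂ] 𝔤)⁆ := rfl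

lemma βk_bracketP (hr : r ≠ 0) (k : X.kFam R) (u v : X.pFam r) :
    X.βk R k (X.bracketP r u v) = r ^ 2 * X.βr hr (X.adLin hr k u) v := by
  rw [X.sq_mul_βr hr, coe_adLin, βR, baseChange_lie R X.β_lie]
  rfl

lemma adLin_skew (hr : r ≠ 0) (k : X.kFam R) (u v : X.pFam r) :
    X.βr hr (X.adLin hr k u) v = - X.βr hr u (X.adLin hr k v) :=
  skew_apply (X.ad hr k).2 u v

lemma adLin_jacobi (hr : r ≠ 0) (u v w : X.pFam r) :
    X.adLin hr (X.bracketP r u v) w + X.adLin hr (X.bracketP r v w) u +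
      X.adLin hr (X.bracketP r w u) v = 0 := by
  apply Subtype.ext
  simp only [Submodule.coe_add, coe_adLin, coe_bracketP, Submodule.coe_zero]
  rw [← lie_skew, ← lie_skew ⁅(v : R ⊗[ℂ] 𝔤), (w : R ⊗[ℂ] 𝔤)⁆,
    ← lie_skew ⁅(w : R ⊗[ℂ] 𝔤), (u : R ⊗[ℂ] 𝔤)⁆, ← neg_add, ← neg_add, neg_eq_zero]
  have := lie_jacobi (u : R ⊗[ℂ] 𝔤) (v : R ⊗[ℂ] 𝔤) (w : R ⊗[ℂ] 𝔤)
  rw [← this]; abel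

lemma adLin_lift (hr : r ≠ 0) (k : X.k) (v : X.p) :
    X.adLin hr (X.liftK R k) (X.liftP r v) = X.liftP r ⟨⁅(k : 𝔤), (v : 𝔤)⁆, X.lie_kp k.2 v.2⟩ := by
  apply Subtype.ext
  rw [coe_adLin]
  change ⁅(1 : R) ⊗ₜ[ℂ] (k : 𝔤), r • (1 : R) ⊗ₜ[ℂ] (v : 𝔤)⁆ = r • (1 : R) ⊗ₜ[ℂ] ⁅(k : 𝔤), (v : 𝔤)⁆
  rw [lie_smul, LieAlgebra.ExtendScalars.bracket_tmul, one_mul]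

variable [FiniteDimensional ℂ 𝔤] [IsPrincipalIdealRing R]

/-- The Casimir element of the family restricts to `r² ⊗ Ω(𝔤, β)`. -/
theorem toConstant_Ω (hr : r ≠ 0) : X.toConstant r (X.Ω hr) = (r ^ 2) ⊗ₜ[ℂ] X.Ωg := by
  obtain ⟨n, x, y, hk⟩ := exists_isDualFamily X.formK_symm X.formK_unimodular
  obtain ⟨m, a, b, hp⟩ := exists_isDualFamily X.formP_symm X.formP_unimodular
  have hι : ∀ z, X.toConstant r (UniversalEnvelopingAlgebra.ι R z) = LinearMap.baseChange R
      (UniversalEnvelopingAlgebra.ι ℂ : 𝔤 →ₗ⁅ℂ⁆ UniversalEnvelopingAlgebra ℂ 𝔤).toLinearMap z :=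
    fun z => UniversalEnvelopingAlgebra.lift_ι_apply R _ _
  have hιK : ∀ v : X.k, X.toConstant r (UniversalEnvelopingAlgebra.ι R (X.kIncl r (X.liftK R v))) =
      (1 : R) ⊗ₜ[ℂ] UniversalEnvelopingAlgebra.ι ℂ (v : 𝔤) := fun v => hι _
  have hιP : ∀ v : X.p, X.toConstant r (UniversalEnvelopingAlgebra.ι R (X.pIncl r (X.liftP r v))) =
      r • (1 : R) ⊗ₜ[ℂ] UniversalEnvelopingAlgebra.ι ℂ (v : 𝔤) := fun v => by
    rw [hι]
    change LinearMap.baseChange R _ (r • (1 : R) ⊗ₜ[ℂ] (v : 𝔤)) = _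
    rw [map_smul]
    rfl
  rw [Ω, Ωg, Unimodular.casimir, Unimodular.casimir, Unimodular.casimir,
    (X.isDualFamily_liftK hk).canonicalElement_eq, (X.isDualFamily_liftP hr hp).canonicalElement_eq,
    (X.isDualFamily_sum hk hp).canonicalElement_eq]
  simp only [map_add, map_smul, map_sum, mulMap_tmul, Function.comp_apply, LinearMap.comp_apply,
    LieHom.coe_toLinearMap, map_mul, hιK, hιP, Fintype.sum_sum_type, Sum.elim_inl, Sum.elim_inr,
    LinearMap.id_apply, TensorProduct.tmul_add, TensorProduct.tmul_sum, Finset.smul_sum,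
    Algebra.TensorProduct.tmul_mul_tmul, TensorProduct.smul_tmul',
    smul_eq_mul, mul_one, sq]

/-- The square of the Dirac operator, with the constant written as a trace of the Casimir element
of `𝔨` on `𝔭`. -/
theorem two_smul_D_sq (hr : r ≠ 0) (hk : IsDualFamily X.formK x y)
    (hp : IsDualFamily X.formP a b) :
    (2 : R) • X.D hr ^ 2 =
      X.Ω hr ⊗ₜ[R] (1 : Cl (X.βr hr)) - r ^ 2 • X.ΔU hr (X.Ωk R) +
        (r ^ 2 * algebraMap ℂ R (1 / 8 * X.casimirTraceP x y a b)) • (1 : X.A hr) := by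
  have hkR := X.isDualFamily_liftK (R := R) hk
  have hpR := X.isDualFamily_liftP hr hp
  let ιU : X.gFam r →ₗ[R] UniversalEnvelopingAlgebra R (X.gFam r) :=
    (UniversalEnvelopingAlgebra.ι R :
      X.gFam r →ₗ⁅R⁆ UniversalEnvelopingAlgebra R (X.gFam r)).toLinearMap
  let iL : UniversalEnvelopingAlgebra R (X.gFam r) →ₗ[R] X.A hr :=
    (Algebra.TensorProduct.includeLeft : _ →ₐ[R] X.A hr).toLinearMap
  let iR : Cl (X.βr hr) →ₐ[R] X.A hr := Algebra.TensorProduct.includeRight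
  let uK : X.kFam R →ₗ[R] X.A hr := iL ∘ₗ ιU ∘ₗ (X.kIncl r).toLinearMap
  let uP : X.pFam r →ₗ[R] X.A hr := iL ∘ₗ ιU ∘ₗ X.pIncl r
  let g : X.pFam r →ₗ[R] X.A hr := iR.toLinearMap ∘ₗ gamma (X.βr hr)
  let αK : X.kFam R →ₗ[R] X.A hr := iR.toLinearMap ∘ₗ (X.α hr : X.kFam R →ₗ[R] _)
  have hg : ∀ u v, g u * g v + g v * g u = algebraMap R (X.A hr) (X.βr hr u v) := by
    intro u v
    change iR (gamma _ u) * iR (gamma _ v) + iR (gamma _ v) * iR (gamma _ u) = _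
    rw [← map_mul iR, ← map_mul iR, ← map_add iR, gamma_mul_add (X.βr_symm hr), AlgHom.commutes]
  have huK : ∀ k, uK k = UniversalEnvelopingAlgebra.ι R (X.kIncl r k) ⊗ₜ[R] 1 := fun k => rfl
  have huP : ∀ k, uP k = UniversalEnvelopingAlgebra.ι R (X.pIncl r k) ⊗ₜ[R] 1 := fun k => rfl
  have hgt : ∀ v, g v = 1 ⊗ₜ[R] gamma (X.βr hr) v := fun v => rfl
  have hαt : ∀ v, αK v = 1 ⊗ₜ[R] X.α hr v := fun v => rfl
  have hug : ∀ u v, uP u * g v = g v * uP u := fun u v => by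
    rw [huP, hgt]; simp
  have huα : ∀ u v, uK u * αK v = αK v * uK u := fun u v => by
    rw [huK, hαt]; simp
  have hα : ∀ k, ∑ j, g (X.adLin hr k (X.liftP r (a j))) * g (X.liftP r (b j)) = 2 • αK k := by
    intro k
    have h1 : X.α hr k = algebraMap ℂ R (1 / 2) •
        ∑ j, gamma (X.βr hr) (X.adLin hr k (X.liftP r (a j))) *
          gamma (X.βr hr) (X.liftP r (b j)) := by
      change (X.βr_unimodular hr).phiLin (X.adLin hr k) = _
      rw [Unimodular.phiLin_apply, hpR.canonicalElement_eq, map_sum]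
      rfl
    have h2 : (2 : ℕ) • X.α hr k = ∑ j, gamma (X.βr hr) (X.adLin hr k (X.liftP r (a j))) *
        gamma (X.βr hr) (X.liftP r (b j)) := by
      rw [h1, ← Nat.cast_smul_eq_nsmul R, smul_smul, ← map_natCast (algebraMap ℂ R) 2, ← map_mul]
      simp
    change _ = 2 • iR (X.α hr k)
    rw [← map_nsmul, h2, map_sum]
    simp only [map_mul]
    rfl
  have hD : X.D hr = ∑ j, uP (X.liftP r (a j)) * g (X.liftP r (b j)) := by
    rw [D, hpR.canonicalElement_eq, map_sum]
    refine Finset.sum_congr rfl fun j _ => ?_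
    rw [huP, hgt]
    simp
  have hΩ : X.Ω hr ⊗ₜ[R] (1 : Cl (X.βr hr)) =
      r ^ 2 • ∑ i, uK (X.liftK R (x i)) * uK (X.liftK R (y i)) +
        ∑ j, uP (X.liftP r (a j)) * uP (X.liftP r (b j)) := by
    change iL (X.Ω hr) = _
    rw [Ω, Unimodular.casimir, Unimodular.casimir, hkR.canonicalElement_eq,
      hpR.canonicalElement_eq, map_add, map_smul, map_sum, map_sum, map_sum, map_sum]
    have hm : ∀ u v, iL (u * v) = iL u * iL v := fun u v =>
      map_mul (Algebra.TensorProduct.includeLeft : _ →ₐ[R] X.A hr) u v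
    simp only [mulMap_tmul, hm]
    rfl
  have hΔ : X.ΔU hr (X.Ωk R) = ∑ i, (uK (X.liftK R (x i)) + αK (X.liftK R (x i))) *
      (uK (X.liftK R (y i)) + αK (X.liftK R (y i))) := by
    rw [Ωk, Unimodular.casimir, hkR.canonicalElement_eq, map_sum, map_sum]
    refine Finset.sum_congr rfl fun i _ => ?_
    rw [mulMap_tmul, map_mul]
    congr 1 <;> exact UniversalEnvelopingAlgebra.lift_ι_apply R _ _
  have hbr : ∀ u v, uP u * uP v - uP v * uP u = uK (X.bracketP r u v) := by
    intro u v
    rw [huP, huP, huK, Algebra.TensorProduct.tmul_mul_tmul, Algebra.TensorProduct.tmul_mul_tmul,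
      ← TensorProduct.sub_tmul, ← LieRing.of_associative_ring_bracket, ← LieHom.map_lie, one_mul]
    rfl
  rw [hD, hΩ, hΔ]
  clear_value uK uP g αK
  refine two_smul_dirac_sq_of_moment hg (X.adLin_skew hr) (X.βk_bracketP hr) hpR hkR
    (fun u v => Subtype.ext (lie_skew _ _).symm) (X.adLin_jacobi hr) hug huα hbr hα ?_
  simp only [Function.comp_apply, adLin_lift, βr_liftP, ← map_sum]
  rw [← map_ofNat (algebraMap ℂ R) 8, ← map_mul, casimirTraceP]
  congr 1
  ring

end QuadraticPair

/-! ### Root spaces and invariant forms -/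

section RootSpaces

open LieAlgebra LieModule

variable {L : Type*} [LieRing L] [LieAlgebra ℂ L] [FiniteDimensional ℂ L]
  {H : LieSubalgebra ℂ L} [H.IsCartanSubalgebra]

lemma linearMap_eq_zero_of_rootSpace {N : Type*} [AddCommGroup N] [Module ℂ N] (f : L →ₗ[ℂ] N)
    (hf : ∀ χ : H → ℂ, ∀ x ∈ rootSpace H χ, f x = 0) : f = 0 := by
  ext x
  have hx : x ∈ (⨆ χ : H → ℂ, rootSpace H χ) := by
    have htop : (⨆ χ : H → ℂ, rootSpace H χ) = ⊤ := iSup_genWeightSpace_eq_top ℂ H L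
    rw [htop]
    trivial
  induction hx using LieSubmodule.iSup_induction' with
  | mem χ x hx => exact hf χ x hx
  | zero => simp
  | add u v _ _ hu hv =>
    rw [map_add, hu, hv]
    simp

lemma mem_rootSpace_zero {x : L} : x ∈ rootSpace H (0 : H → ℂ) ↔ x ∈ H := by
  rw [rootSpace_zero_eq ℂ L H]
  rfl

variable {B : BilinForm ℂ L} (hB : ∀ x y z, B ⁅x, y⁆ z = B x ⁅y, z⁆)
include hB

omit [FiniteDimensional ℂ L] in
/-- Root spaces that do not belong to opposite weights are orthogonal for every invariant form. -/
lemma rootSpace_orthogonal {χ ψ : H → ℂ} (hχ : χ + ψ ≠ 0) {x y : L} (hx : x ∈ rootSpace H χ)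
    (hy : y ∈ rootSpace H ψ) : B x y = 0 := by
  obtain ⟨h, hh⟩ := Function.ne_iff.1 hχ
  rw [rootSpace, mem_genWeightSpace] at hx hy
  obtain ⟨n, hn⟩ := hx h
  obtain ⟨m, hm⟩ := hy h
  set f := toEnd ℂ H L h - χ h • (1 : Module.End ℂ L) with hf
  set g := toEnd ℂ H L h - ψ h • (1 : Module.End ℂ L) with hg
  clear hx hy
  -- Induction on the sum of the nilpotency indices, as
  -- `(χ + ψ)(h) B(x, y) = - B(f x, y) - B(x, g y)`.
  induction hN : n + m using Nat.strong_induction_on generalizing n m x y with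
  | _ N ih =>
    rcases n with _ | n
    · have : x = 0 := by simpa using hn
      simp [this]
    rcases m with _ | m
    · have : y = 0 := by simpa using hm
      simp [this]
    rw [pow_succ] at hn hm
    have h1 : B (f x) y = 0 := ih _ (by omega) n (m + 1) hn (by rwa [pow_succ]) rfl
    have h2 : B x (g y) = 0 := ih _ (by omega) (n + 1) m (by rwa [pow_succ]) hm rfl
    have h3 : B ⁅(h : L), x⁆ y = - B x ⁅(h : L), y⁆ := by
      rw [← lie_skew, map_neg, LinearMap.neg_apply, hB]
    have e1 : f x = ⁅(h : L), x⁆ - χ h • x := rfl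
    have e2 : g y = ⁅(h : L), y⁆ - ψ h • y := rfl
    rw [e1, map_sub, LinearMap.sub_apply, map_smul, LinearMap.smul_apply, h3, smul_eq_mul] at h1
    rw [e2, map_sub, map_smul, smul_eq_mul] at h2
    have h4 : (χ h + ψ h) * B x y = 0 := by linear_combination - h1 - h2
    exact (mul_eq_zero.1 h4).resolve_left hh

/-- A nondegenerate invariant form is nondegenerate on every Cartan subalgebra. -/
lemma nondegenerate_cartan (hs : ∀ x y, B x y = B y x) (hn : B.Nondegenerate) :
    (pullForm B H.toSubmodule.subtype).Nondegenerate := by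
  have key : ∀ x : H, (∀ y : H, B x y = 0) → x = 0 := by
    intro x hx
    have : B (x : L) = 0 := by
      refine linearMap_eq_zero_of_rootSpace (H := H) _ fun χ y hy => ?_
      by_cases hχ : χ = 0
      · subst hχ
        exact hx ⟨y, mem_rootSpace_zero.1 hy⟩
      · exact rootSpace_orthogonal hB (χ := 0) (by simpa using hχ) (mem_rootSpace_zero.2 x.2) hy
    exact Subtype.ext (hn.1 _ fun y => by rw [this]; rfl)
  refine ⟨fun x hx => key x hx, fun x hx => key x fun y => ?_⟩
  rw [hs]
  exact hx y

end RootSpaces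

section FaithfulTraceForm

open LieAlgebra LieModule

variable {L : Type*} [LieRing L] [LieAlgebra ℂ L]

/-- The trace form of the module `M` is nondegenerate on the derived algebra of `L`, in the sense
that no nonzero element of `[L, L]` is orthogonal to `L`. This is the form in which reductivity
is used. -/
def SeparatesDerived (L : Type*) [LieRing L] [LieAlgebra ℂ L] (M : Type*) [AddCommGroup M]
    [Module ℂ M] [LieRingModule L M] [LieModule ℂ L M] : Prop :=
  ∀ x ∈ (⁅(⊤ : LieIdeal ℂ L), (⊤ : LieIdeal ℂ L)⁆ : LieIdeal ℂ L),
    (∀ y, traceForm ℂ L M x y = 0) → x = 0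

variable [FiniteDimensional ℂ L] {H : LieSubalgebra ℂ L} [H.IsCartanSubalgebra]
  {M : Type*} [AddCommGroup M] [Module ℂ M] [LieRingModule L M] [LieModule ℂ L M]

omit [FiniteDimensional ℂ L] in
lemma rootSpace_le_derived {χ : H → ℂ} (hχ : χ ≠ 0) {x : L} (hx : x ∈ rootSpace H χ) :
    x ∈ (⁅(⊤ : LieIdeal ℂ L), (⊤ : LieIdeal ℂ L)⁆ : LieIdeal ℂ L) := by
  obtain ⟨h, hh⟩ := Function.ne_iff.1 hχ
  rw [rootSpace, mem_genWeightSpace] at hx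
  obtain ⟨n, hn⟩ := hx h
  clear hx
  induction n generalizing x with
  | zero =>
    have : x = 0 := by simpa using hn
    rw [this]
    exact zero_mem _
  | succ n ih =>
    rw [pow_succ] at hn
    have h1 := ih hn
    have e1 : (toEnd ℂ H L h - χ h • (1 : Module.End ℂ L)) x = ⁅(h : L), x⁆ - χ h • x := rfl
    rw [e1] at h1
    have h2 : ⁅(h : L), x⁆ ∈ (⁅(⊤ : LieIdeal ℂ L), (⊤ : LieIdeal ℂ L)⁆ : LieIdeal ℂ L) :=
      LieSubmodule.lie_mem_lie trivial trivial
    have h3 : x = (χ h)⁻¹ • (⁅(h : L), x⁆ - (⁅(h : L), x⁆ - χ h • x)) := by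
      rw [sub_sub_cancel, smul_smul, inv_mul_cancel₀ hh, one_smul]
    rw [h3]
    exact Submodule.smul_mem _ _ (sub_mem h2 h1)

variable [FiniteDimensional ℂ M] (hM : SeparatesDerived L M)
include hM

lemma cartan_lie_eq_zero (x y : H) : ⁅(x : L), (y : L)⁆ = 0 := by
  apply hM _ (LieSubmodule.lie_mem_lie trivial trivial)
  suffices h : traceForm ℂ L M ⁅(x : L), (y : L)⁆ = 0 from fun z => by rw [h]; rfl
  refine linearMap_eq_zero_of_rootSpace (H := H) _ fun χ z hz => ?_
  by_cases hχ : χ = 0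
  · subst hχ
    have h1 := traceForm_eq_sum_finrank_nsmul_mul ℂ H M ⁅x, y⁆ ⟨z, mem_rootSpace_zero.1 hz⟩
    change traceForm ℂ L M ⁅(x : L), (y : L)⁆ z = _ at h1
    rw [h1]
    simp [Weight.apply_lie]
  · exact rootSpace_orthogonal (traceForm_apply_lie_apply ℂ L M) (χ := 0) (by simpa using hχ)
      (mem_rootSpace_zero.2 ⁅x, y⁆.2) hz

/-- A root vector `e`, a vector `f` of the opposite root space and their bracket `t ∈ H`, with
`α(t) ≠ 0`. It is not claimed that `f` is an eigenvector. -/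
lemma exists_root_triple {α : H → ℂ} (h0 : α ≠ 0) (hα : rootSpace H α ≠ ⊥) :
    ∃ e f : L, ∃ t : H, e ≠ 0 ∧ (∀ h : H, ⁅(h : L), e⁆ = α h • e) ∧ e ∈ rootSpace H α ∧
      f ∈ rootSpace H (-α) ∧ ⁅e, f⁆ = t ∧ α t ≠ 0 := by
  obtain ⟨e, he0, he⟩ := exists_forall_lie_eq_smul ℂ H L ⟨α, hα⟩
  replace he : ∀ h : H, ⁅(h : L), e⁆ = α h • e := he
  have heα : e ∈ rootSpace H α :=
    weightSpace_le_genWeightSpace L α ((mem_weightSpace α e).2 he)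
  have h1 : ∃ f ∈ rootSpace H (-α), traceForm ℂ L M e f ≠ 0 := by
    by_contra! hcon
    apply he0
    apply hM _ (rootSpace_le_derived h0 heα)
    suffices h : traceForm ℂ L M e = 0 from fun z => by rw [h]; rfl
    refine linearMap_eq_zero_of_rootSpace (H := H) _ fun χ z hz => ?_
    by_cases hχ : α + χ = 0
    · rw [add_eq_zero_iff_neg_eq] at hχ
      exact hcon z (hχ ▸ hz)
    · exact rootSpace_orthogonal (traceForm_apply_lie_apply ℂ L M) hχ heα hz
  obtain ⟨f, hf, hef⟩ := h1
  have ht : ⁅e, f⁆ ∈ H := by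
    have := lie_mem_genWeightSpace_of_mem_genWeightSpace heα hf
    rw [add_neg_cancel] at this
    exact mem_rootSpace_zero.1 this
  refine ⟨e, f, ⟨_, ht⟩, he0, he, heα, hf, rfl, fun h2 => ?_⟩
  -- All weights of `M` would vanish on `t`, so that `t` would be orthogonal to `H`.
  have h3 : ∀ χ : Weight ℂ H M, χ ⟨_, ht⟩ = 0 := by
    intro χ
    obtain ⟨a, b, hb, hab⟩ := exists_forall_mem_corootSpace_smul_add_eq_zero M α χ h0
      χ.genWeightSpace_ne_bot
    have := hab ⟨_, ht⟩ ((mem_corootSpace' α).2 (Submodule.subset_span ⟨e, heα, f, hf, rfl⟩))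
    simp only [Pi.add_apply, Pi.smul_apply, h2, smul_zero, zero_add] at this
    exact (smul_eq_zero.1 this).resolve_left hb.ne'
  obtain ⟨h, hh⟩ := Function.ne_iff.1 h0
  have h4 := traceForm_eq_sum_finrank_nsmul_mul ℂ H M h ⟨_, ht⟩
  change traceForm ℂ L M h ⁅e, f⁆ = _ at h4
  rw [← traceForm_apply_lie_apply, he] at h4
  simp only [h3, mul_zero, smul_zero, Finset.sum_const_zero, map_smul, LinearMap.smul_apply,
    smul_eq_mul] at h4
  exact (mul_ne_zero hh hef) h4

/-- The space opposite to a root has dimension one. With `e, f, t` as in `exists_root_triple`, the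
operator `ad t = [ad e, ad f]` has trace zero on the sum of `ℂ e` and of the spaces of weight
`-n α` for `n ≥ 0`, so that `∑ₙ n dim L₋ₙα = 1`. -/
lemma rootSpace_neg_ne_bot_and_finrank {α : H → ℂ} (h0 : α ≠ 0) (hα : rootSpace H α ≠ ⊥) :
    rootSpace H (-α) ≠ ⊥ ∧ Module.finrank ℂ (rootSpace H (-α)) = 1 := by
  obtain ⟨e, f, t, he0, he, heα, hf, hef, hαt⟩ := exists_root_triple hM h0 hα
  have hbot : rootSpace H (-α) ≠ ⊥ := by
    intro hbot
    have : f = 0 := by simpa [hbot] using hf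
    apply hαt
    have ht0 : t = 0 := Subtype.ext (by rw [← hef, this, lie_zero]; rfl)
    have := he t
    rw [ht0, ZeroMemClass.coe_zero, zero_lie] at this
    rw [ht0]
    exact (smul_eq_zero.1 this.symm).resolve_right he0
  refine ⟨hbot, ?_⟩
  obtain ⟨n, hn0, hn⟩ := exists_genWeightSpace_smul_add_eq_bot L (-α) 0 (neg_ne_zero.2 h0)
  let F : ℤ → Submodule ℂ L := fun k =>
    if k = 1 then ℂ ∙ e else (rootSpace H (k • α)).toSubmodule
  have F1 : F 1 = ℂ ∙ e := if_pos rfl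
  have Fk : ∀ k, k ≠ 1 → F k = (rootSpace H (k • α)).toSubmodule := fun k hk => if_neg hk
  have hF : ∀ k, F k ≤ (rootSpace H (k • α)).toSubmodule := by
    intro k
    by_cases hk : k = 1
    · subst hk
      rw [F1, Submodule.span_singleton_le_iff_mem, one_smul]
      exact heα
    · exact (Fk k hk).le
  have Fn : F (-n) = ⊥ := by
    rw [Fk _ (by omega), LieSubmodule.toSubmodule_eq_bot]
    rw [add_zero, smul_neg] at hn
    rw [rootSpace, neg_smul, natCast_zsmul]
    exact hn
  let s : Finset ℤ := Finset.Ioc (-(n : ℤ)) 1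
  have hind : iSupIndep fun i : s => F i := by
    have h1 : iSupIndep fun k : ℤ => (rootSpace H (k • α)).toSubmodule := by
      rw [LieSubmodule.iSupIndep_toSubmodule]
      exact (iSupIndep_genWeightSpace ℂ H L).comp (smul_left_injective ℤ h0)
    exact (h1.mono hF).comp Subtype.val_injective
  have ht : ∀ k, Set.MapsTo (toEnd ℂ L L t) (F k) (F k) := by
    intro k x hx
    by_cases hk : k = 1
    · subst hk
      rw [F1] at hx ⊢
      obtain ⟨c, rfl⟩ := Submodule.mem_span_singleton.1 hx
      change ⁅(t : L), c • e⁆ ∈ _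
      rw [lie_smul, he]
      exact Submodule.smul_mem _ _ (Submodule.smul_mem _ _ (Submodule.mem_span_singleton_self e))
    · rw [Fk k hk] at hx ⊢
      exact (rootSpace H (k • α)).lie_mem (x := t) hx
  set W : Submodule ℂ L := ⨆ i ∈ s, F i with hW
  have hle : ∀ k ∈ s, F k ≤ W := fun k hk => le_biSup F hk
  have hWind : ∀ (T : L →ₗ[ℂ] L), (∀ k ∈ s, ∀ x ∈ F k, T x ∈ W) → ∀ x ∈ W, T x ∈ W := by
    intro T hT
    have : W ≤ W.comap T := iSup₂_le fun k hk x hx => hT k hk x hx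
    exact this
  have hadd : ∀ {k m : ℤ} {x y : L}, x ∈ rootSpace H (m • α) → y ∈ F k →
      ⁅x, y⁆ ∈ rootSpace H ((m + k) • α) := by
    intro k m x y hx hy
    rw [add_smul]
    exact lie_mem_genWeightSpace_of_mem_genWeightSpace hx (hF k hy)
  have hWe : ∀ x ∈ W, toEnd ℂ L L e x ∈ W := by
    refine hWind _ fun k hk x hx => ?_
    rw [toEnd_apply_apply]
    rw [Finset.mem_Ioc] at hk
    by_cases hk1 : k = 1
    · subst hk1
      rw [F1] at hx
      obtain ⟨c, rfl⟩ := Submodule.mem_span_singleton.1 hx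
      simp
    by_cases hk0 : k = 0
    · subst hk0
      rw [Fk 0 (by omega), zero_smul] at hx
      have hxH := mem_rootSpace_zero.1 hx
      rw [← lie_skew, he ⟨x, hxH⟩]
      refine neg_mem (Submodule.smul_mem _ _ (hle 1 (Finset.mem_Ioc.2 (by omega)) ?_))
      rw [F1]
      exact Submodule.mem_span_singleton_self e
    · refine hle (1 + k) (Finset.mem_Ioc.2 (by omega)) ?_
      rw [Fk _ (by omega)]
      exact hadd (by rwa [one_smul]) hx
  have hWf : ∀ x ∈ W, toEnd ℂ L L f x ∈ W := by
    refine hWind _ fun k hk x hx => ?_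
    rw [toEnd_apply_apply]
    rw [Finset.mem_Ioc] at hk
    have h1 : ⁅f, x⁆ ∈ F (-1 + k) := by
      rw [Fk _ (by omega)]
      exact hadd (by rwa [neg_smul, one_smul]) hx
    by_cases hkn : -1 + k = -(n : ℤ)
    · rw [hkn, Fn, Submodule.mem_bot] at h1
      rw [h1]
      exact zero_mem _
    · exact hle _ (Finset.mem_Ioc.2 (by omega)) h1
  have hWt : Set.MapsTo (toEnd ℂ L L t) W W := hWind _ fun k hk x hx => hle k hk (ht k hx)
  have htr0 : LinearMap.trace ℂ W ((toEnd ℂ L L t).restrict hWt) = 0 := by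
    have : (toEnd ℂ L L t).restrict hWt =
        (toEnd ℂ L L e).restrict hWe * (toEnd ℂ L L f).restrict hWf -
          (toEnd ℂ L L f).restrict hWf * (toEnd ℂ L L e).restrict hWe := by
      ext x
      change ⁅(t : L), (x : L)⁆ = ⁅e, ⁅f, (x : L)⁆⁆ - ⁅f, ⁅e, (x : L)⁆⁆
      rw [← hef, lie_lie]
    rw [this, map_sub, LinearMap.trace_mul_comm, sub_self]
  rw [LinearMap.trace_eq_sum_trace_restrict_of_eq_biSup s hind ht W hW hWt] at htr0
  have htr1 : LinearMap.trace ℂ (F 1) ((toEnd ℂ L L t).restrict (ht 1)) = α t := by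
    have : (toEnd ℂ L L t).restrict (ht 1) = α t • LinearMap.id := by
      ext ⟨x, hx⟩
      rw [F1] at hx
      obtain ⟨c, rfl⟩ := Submodule.mem_span_singleton.1 hx
      change ⁅(t : L), c • e⁆ = α t • c • e
      rw [lie_smul, he, smul_comm]
    rw [this, map_smul, LinearMap.trace_id, F1, finrank_span_singleton he0]
    simp
  have htrk : ∀ k, k ≠ 1 → LinearMap.trace ℂ (F k) ((toEnd ℂ L L t).restrict (ht k)) =
      α t * ((k * Module.finrank ℂ (rootSpace H (k • α)) : ℤ) : ℂ) := by
    intro k hk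
    have h1 := trace_toEnd_genWeightSpace ℂ H L (k • α) t
    have h2 : ∀ (N : Submodule ℂ L) (hN : N = (rootSpace H (k • α)).toSubmodule)
        (hm : Set.MapsTo (toEnd ℂ L L t) N N),
        LinearMap.trace ℂ N ((toEnd ℂ L L t).restrict hm) =
          LinearMap.trace ℂ (rootSpace H (k • α)) (toEnd ℂ H (rootSpace H (k • α)) t) := by
      rintro _ rfl hm
      rfl
    rw [h2 _ (Fk k hk), h1]
    simp
    ring
  have h1s : (1 : ℤ) ∈ s := Finset.mem_Ioc.2 (by omega)
  rw [← Finset.add_sum_erase _ _ h1s, htr1,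
    Finset.sum_congr rfl fun k hk => htrk k (Finset.ne_of_mem_erase hk), ← Finset.mul_sum] at htr0
  have hsum : (1 : ℤ) + ∑ k ∈ s.erase 1, k * (Module.finrank ℂ (rootSpace H (k • α)) : ℤ) = 0 := by
    have h1 : α t * ((1 + ∑ k ∈ s.erase 1, k * (Module.finrank ℂ (rootSpace H (k • α)) : ℤ) : ℤ)
        : ℂ) = 0 := by
      rw [← htr0]
      push_cast
      ring
    exact_mod_cast (mul_eq_zero.1 h1).resolve_left hαt
  have hn1 : n ≠ 1 := by
    rintro rfl
    rw [one_smul, add_zero] at hn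
    exact hbot hn
  have hmem : (-1 : ℤ) ∈ s.erase 1 :=
    Finset.mem_erase.2 ⟨by norm_num, Finset.mem_Ioc.2 (by omega)⟩
  have hle1 := Finset.single_le_sum (s := s.erase 1)
    (f := fun k : ℤ => (-k) * (Module.finrank ℂ (rootSpace H (k • α)) : ℤ)) (fun k hk => by
      have hk' := Finset.mem_erase.1 hk
      have := Finset.mem_Ioc.1 hk'.2
      exact mul_nonneg (by omega) (by positivity)) hmem
  simp only [neg_mul, Finset.sum_neg_distrib] at hle1
  have hα1 : (-1 : ℤ) • α = -α := by rw [neg_smul, one_smul]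
  rw [hα1] at hle1
  have hpos : 0 < Module.finrank ℂ (rootSpace H (-α)) := by
    have : Nontrivial (rootSpace H (-α)) := (LieSubmodule.nontrivial_iff_ne_bot ℂ H L).2 hbot
    exact Module.finrank_pos
  omega

lemma rootSpace_neg_ne_bot {α : H → ℂ} (h0 : α ≠ 0) (hα : rootSpace H α ≠ ⊥) :
    rootSpace H (-α) ≠ ⊥ :=
  (rootSpace_neg_ne_bot_and_finrank hM h0 hα).1

lemma finrank_rootSpace {α : H → ℂ} (h0 : α ≠ 0) (hα : rootSpace H α ≠ ⊥) :
    Module.finrank ℂ (rootSpace H α) = 1 := by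
  have := (rootSpace_neg_ne_bot_and_finrank hM (neg_ne_zero.2 h0)
    (rootSpace_neg_ne_bot hM h0 hα)).2
  rwa [neg_neg] at this

end FaithfulTraceForm

/-! ### The spin map and the strange formula -/

section HighestWeightVector

variable {M : Type*} [AddCommGroup M] [Module ℂ M] {B : BilinForm ℂ M}
  {ι : Type*} {x : ι → M}

lemma gamma_mul_prod_eq_zero (hs : ∀ u v, B u v = B v u) (hx : ∀ i j, B (x i) (x j) = 0)
    {l : List ι} {i : ι} (hi : i ∈ l) :
    gamma B (x i) * (l.map fun j => gamma B (x j)).prod = 0 := by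
  induction l with
  | nil => simp at hi
  | cons j l ih =>
    have h1 := gamma_mul_add hs (x i) (x j)
    rw [hx, map_zero] at h1
    rw [List.map_cons, List.prod_cons, ← mul_assoc]
    rcases List.mem_cons.1 hi with rfl | hi
    · rw [← two_nsmul] at h1
      rw [nsmul_cancel (S := ℂ) 2 two_ne_zero (h1.trans (smul_zero 2).symm), zero_mul]
    · rw [eq_neg_of_add_eq_zero_left h1, neg_mul, mul_assoc, ih hi, mul_zero, neg_zero]

lemma contractLeft_prod_eq_zero {d : Module.Dual ℂ M} {l : List ι} (hd : ∀ i ∈ l, d (x i) = 0) :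
    CliffordAlgebra.contractLeft d (l.map fun j => gamma B (x j)).prod = 0 := by
  induction l with
  | nil => simp
  | cons j l ih =>
    rw [List.map_cons, List.prod_cons, gamma, CliffordAlgebra.contractLeft_ι_mul,
      hd j List.mem_cons_self, zero_smul, ← gamma, ih fun i hi => hd i (List.mem_cons_of_mem _ hi),
      mul_zero, sub_zero]

/-- A product of linearly independent vectors is not zero in the Clifford algebra, since it can
be contracted to `1`. -/
lemma prod_gamma_ne_zero (d : ι → Module.Dual ℂ M) (h1 : ∀ i, d i (x i) = 1)
    (h0 : ∀ i j, i ≠ j → d i (x j) = 0) {l : List ι} (hl : l.Nodup) :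
    (l.map fun j => gamma B (x j)).prod ≠ 0 := by
  induction l with
  | nil => simp
  | cons i l ih =>
    obtain ⟨hil, hl⟩ := List.nodup_cons.1 hl
    intro h
    apply ih hl
    have h2 := congrArg (CliffordAlgebra.contractLeft (d i)) h
    rw [List.map_cons, List.prod_cons, gamma, CliffordAlgebra.contractLeft_ι_mul, h1, one_smul,
      ← gamma, contractLeft_prod_eq_zero fun j hj => h0 i j (by rintro rfl; exact hil hj), mul_zero,
      sub_zero, map_zero] at h2
    exact h2

end HighestWeightVector

section Spin

attribute [local instance 2000] LieRing.ofAssociativeRing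

variable {L : Type*} [LieRing L] [LieAlgebra ℂ L] [FiniteDimensional ℂ L] {B : BilinForm ℂ L}

/-- The spin map `L → so(L, B) → Cl(L, B)` of a Lie algebra with an invariant form. -/
def spin (hB : Unimodular B) : L →ₗ[ℂ] Cl B :=
  hB.phiLin ∘ₗ (LieAlgebra.ad ℂ L : L →ₗ[ℂ] Module.End ℂ L)

lemma spin_lie (hB : Unimodular B) (hs : ∀ x y, B x y = B y x)
    (hi : ∀ x y z, B ⁅x, y⁆ z = B x ⁅y, z⁆) (x y : L) :
    spin hB ⁅x, y⁆ = spin hB x * spin hB y - spin hB y * spin hB x := by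
  have hm : ∀ z : L, LieAlgebra.ad ℂ L z ∈ skewAdjointLieSubalgebra B := fun z =>
    (LinearMap.mem_skewAdjointSubmodule _).2 fun u v => by
      change B ⁅z, u⁆ v = B u (-⁅z, v⁆)
      rw [map_neg, form_lie_skew hi]
  have h := (hB.phi hs).map_lie ⟨_, hm x⟩ ⟨_, hm y⟩
  rw [LieRing.of_associative_ring_bracket] at h
  change _ = spin hB x * spin hB y - spin hB y * spin hB x at h
  rw [← h]
  change hB.phiLin _ = hB.phiLin ⁅LieAlgebra.ad ℂ L x, LieAlgebra.ad ℂ L y⁆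
  rw [← LieHom.map_lie]
  rfl

lemma two_nsmul_spin (hB : Unimodular B) {σ : Type*} [Fintype σ] {z w : σ → L}
    (hd : IsDualFamily B z w) (x : L) :
    2 • spin hB x = ∑ i, gamma B ⁅x, z i⁆ * gamma B (w i) := by
  have h1 : spin hB x = (1 / 2 : ℂ) • ∑ i, gamma B ⁅x, z i⁆ * gamma B (w i) := by
    change hB.phiLin _ = _
    rw [Unimodular.phiLin_apply, hd.canonicalElement_eq, map_sum]
    rfl
  rw [h1, ← Nat.cast_smul_eq_nsmul ℂ, smul_smul]
  norm_num

/-- The spin map sends the Casimir element to one eighth of its trace in the adjoint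
representation. -/
lemma sum_spin_mul_spin (hB : Unimodular B) (hs : ∀ x y, B x y = B y x)
    (hi : ∀ x y z, B ⁅x, y⁆ z = B x ⁅y, z⁆) {σ : Type*} [Fintype σ] {z w : σ → L}
    (hd : IsDualFamily B z w) :
    8 • ∑ i, spin hB (z i) * spin hB (w i) = algebraMap ℂ (Cl B) (casimirTrace B z w) := by
  let ad' : L →ₗ[ℂ] Module.End ℂ L := (LieAlgebra.ad ℂ L : L →ₗ[ℂ] Module.End ℂ L)
  have h := sum_spin_casimir (act := ad') (μ := ad') (c := 1) (gamma_mul_add hs)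
    (fun x u v => form_lie_skew hi x u v)
    (fun x u v => by rw [one_mul]; exact (hi x u v).symm) hd hd (fun u v => (lie_skew u v).symm)
    (fun u v w => by
      change ⁅⁅u, v⁆, w⁆ + ⁅⁅v, w⁆, u⁆ + ⁅⁅w, u⁆, v⁆ = 0
      rw [← lie_skew, ← lie_skew ⁅v, w⁆, ← lie_skew ⁅w, u⁆, ← neg_add, ← neg_add, neg_eq_zero]
      have := lie_jacobi u v w
      rw [← this]; abel)
  have e : ∀ x, ∑ l, gamma B (ad' x (z l)) * gamma B (w l) = 2 • spin hB x := fun x =>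
    (two_nsmul_spin hB hd x).symm
  simp only [e, one_smul] at h
  rw [casimirTrace]
  refine Eq.trans ?_ h
  simp only [smul_mul_smul_comm, ← Finset.smul_sum, smul_smul]
  norm_num

/-- A sum over dual families does not depend on the families. -/
lemma sum_spin_mul_spin_congr (hB : Unimodular B) {σ τ : Type*} [Fintype σ] [Fintype τ]
    {z w : σ → L} {z' w' : τ → L} (hd : IsDualFamily B z w) (hd' : IsDualFamily B z' w') :
    ∑ i, spin hB (z i) * spin hB (w i) = ∑ i, spin hB (z' i) * spin hB (w' i) := by
  have h := hd.canonicalElement_eq hB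
  rw [hd'.canonicalElement_eq hB] at h
  have h2 := congrArg (mulMap (spin hB) (spin hB)) h
  rw [map_sum, map_sum] at h2
  exact h2.symm

end Spin

section StrangeFormula

open LieAlgebra LieModule

variable {L : Type*} [LieRing L] [LieAlgebra ℂ L] [FiniteDimensional ℂ L]
  {H : LieSubalgebra ℂ L} [H.IsCartanSubalgebra]
  {M : Type*} [AddCommGroup M] [Module ℂ M] [LieRingModule L M] [LieModule ℂ L M]
  [FiniteDimensional ℂ M] {B : BilinForm ℂ L}

lemma exists_dual_of_rootSpace_ne_bot {χ : H → ℂ} (hχ : rootSpace H χ ≠ ⊥) :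
    ∃ α : Module.Dual ℂ H, (α : H → ℂ) = χ :=
  ⟨Weight.toLinear ℂ H L ⟨χ, hχ⟩, rfl⟩

/-- Root vectors `e` and `f` for `α` and `-α` with `B(e, f) = 1`. -/
lemma exists_root_pair (hM : SeparatesDerived L M) (hi : ∀ x y z, B ⁅x, y⁆ z = B x ⁅y, z⁆)
    (hn : B.Nondegenerate) {α : Module.Dual ℂ H} (hα : IsRoot H α) :
    ∃ e f : L, e ∈ rootSpace H α ∧ f ∈ rootSpace H (-α : H → ℂ) ∧ B e f = 1 ∧
      (∀ h : H, ⁅(h : L), e⁆ = α h • e) ∧ (∀ x ∈ rootSpace H α, ∃ c : ℂ, c • e = x) ∧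
      ∀ x ∈ rootSpace H (-α : H → ℂ), ∃ c : ℂ, c • f = x := by
  have h0 : (α : H → ℂ) ≠ 0 := fun h => hα.1 (LinearMap.ext fun x => congrFun h x)
  obtain ⟨e, -, -, he0, he, heα, -⟩ := exists_root_triple hM h0 hα.2
  have h1 := finrank_rootSpace hM h0 hα.2
  obtain ⟨hbot, h2⟩ := rootSpace_neg_ne_bot_and_finrank hM h0 hα.2
  have hex : ∃ f ∈ rootSpace H (-α : H → ℂ), B e f ≠ 0 := by
    by_contra! hcon
    apply he0
    apply hn.1
    suffices h : B e = 0 from fun z => by rw [h]; rfl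
    refine linearMap_eq_zero_of_rootSpace (H := H) _ fun χ z hz => ?_
    by_cases hχ : (α : H → ℂ) + χ = 0
    · rw [add_eq_zero_iff_neg_eq] at hχ
      exact hcon z (hχ ▸ hz)
    · exact rootSpace_orthogonal hi hχ heα hz
  obtain ⟨f, hf, hef⟩ := hex
  have hspan : ∀ (N : LieSubmodule ℂ H L), Module.finrank ℂ N = 1 → ∀ u ∈ N, u ≠ 0 → ∀ x ∈ N,
      ∃ c : ℂ, c • u = x := by
    intro N hN u hu hu0 x hx
    obtain ⟨c, hc⟩ := (finrank_eq_one_iff_of_nonzero' (⟨u, hu⟩ : N)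
      fun h => hu0 (congrArg Subtype.val h)).1 hN ⟨x, hx⟩
    exact ⟨c, congrArg Subtype.val hc⟩
  have hf' : (B e f)⁻¹ • f ∈ rootSpace H (-α : H → ℂ) := Submodule.smul_mem _ _ hf
  refine ⟨e, (B e f)⁻¹ • f, heα, hf', ?_, he, hspan _ h1 e heα he0, hspan _ h2 _ hf' ?_⟩
  · rw [map_smul, smul_eq_mul, inv_mul_cancel₀ hef]
  · rintro h
    rw [smul_eq_zero, inv_eq_zero] at h
    rcases h with h | h
    · exact hef h
    · exact hef (by rw [h, map_zero])

/-- The strange formula of Freudenthal and de Vries: `24 ‖ρ‖²` is the trace of the Casimir element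
in the adjoint representation. The product of the positive root vectors in `Cl(L, B)` is a highest
weight vector of weight `ρ` for the spin map; the Casimir element acts on it by
`‖ρ‖² + 2 ‖ρ‖²`, and by one eighth of its trace. -/
theorem casimirTrace_eq (hM : SeparatesDerived L M) (hs : ∀ x y, B x y = B y x)
    (hi : ∀ x y z, B ⁅x, y⁆ z = B x ⁅y, z⁆) (hn : B.Nondegenerate)
    {P : Finset (Module.Dual ℂ H)} (hP : IsPositiveSystem H P)
    (hH : (pullForm B H.toSubmodule.subtype).Nondegenerate)
    {σ : Type*} [Fintype σ] {z w : σ → L} (hd : IsDualFamily B z w) :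
    casimirTrace B z w = 24 * dualNormSq _ hH (halfSum P) := by
  classical
  have hB : Unimodular B := unimodular_of_nondegenerate hn
  set BH := pullForm B H.toSubmodule.subtype with hBH
  obtain ⟨n, x, y, hxy⟩ := exists_isDualFamily (fun u v => hs u v : ∀ u v, BH u v = BH v u)
    (unimodular_of_nondegenerate hH)
  choose e f he hf hef hhe hespan hfspan using
    fun α : P => exists_root_pair hM hi hn (hP.isRoot α α.2)
  have hne : ∀ α : P, ∀ β : P, ((α : Module.Dual ℂ H) : H → ℂ) + (β : Module.Dual ℂ H) ≠ 0 := by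
    intro α β h
    have h1 : -(α : Module.Dual ℂ H) = β := by
      rw [← add_eq_zero_iff_neg_eq]
      exact LinearMap.ext fun u => congrFun h u
    have h2 := hP.xor α (hP.isRoot α α.2)
    rw [h1] at h2
    rcases h2 with h2 | h2
    · exact h2.2 β.2
    · exact h2.2 α.2
  have hne0 : ∀ α : P, ((α : Module.Dual ℂ H) : H → ℂ) ≠ 0 := fun α h =>
    hne α α (by rw [h, add_zero])
  have hinj : ∀ α β : P, α ≠ β → ((α : Module.Dual ℂ H) : H → ℂ) ≠ (β : Module.Dual ℂ H) :=
    fun α β h h' => h (Subtype.ext (DFunLike.coe_injective h'))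
  have orth : ∀ {χ ψ : H → ℂ}, χ + ψ ≠ 0 → ∀ {u v : L}, u ∈ rootSpace H χ → v ∈ rootSpace H ψ →
      B u v = 0 := fun h _ _ hu hv => rootSpace_orthogonal hi h hu hv
  have hee : ∀ α β, B (e α) (e β) = 0 := fun α β => orth (hne α β) (he α) (he β)
  have hff : ∀ α β, B (f α) (f β) = 0 := fun α β => orth
    (by rw [← neg_add]; exact neg_ne_zero.2 (hne α β)) (hf α) (hf β)
  have hef0 : ∀ α β, α ≠ β → B (e α) (f β) = 0 := fun α β h => orth
    (by rw [← sub_eq_add_neg]; exact sub_ne_zero.2 (hinj α β h)) (he α) (hf β)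
  have heh : ∀ α (h : H), B (e α) h = 0 := fun α h => orth
    (by rw [add_zero]; exact hne0 α) (he α) (mem_rootSpace_zero.2 h.2)
  have hfh : ∀ α (h : H), B (f α) h = 0 := fun α h => orth
    (by rw [add_zero]; exact neg_ne_zero.2 (hne0 α)) (hf α) (mem_rootSpace_zero.2 h.2)
  -- The dual families adapted to the root decomposition.
  let z' : Fin n ⊕ (P ⊕ P) → L := Sum.elim (fun i => (x i : L)) (Sum.elim e f)
  let w' : Fin n ⊕ (P ⊕ P) → L := Sum.elim (fun i => (y i : L)) (Sum.elim f e)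
  have hd' : IsDualFamily B z' w' := by
    refine IsDualFamily.of_left hs hB.injective fun v => ?_
    let T : L →ₗ[ℂ] L := ∑ i, (B (z' i)).smulRight (w' i) - LinearMap.id
    have hTv : ∀ v, T v = ∑ i, B (z' i) v • w' i - v := fun v => by simp [T]
    suffices h : T = 0 by
      rw [← sub_eq_zero, ← hTv, h]
      rfl
    refine linearMap_eq_zero_of_rootSpace (H := H) _ fun χ v hv => ?_
    rw [hTv, sub_eq_zero]
    simp only [Fintype.sum_sum_type, z', w', Sum.elim_inl, Sum.elim_inr]
    by_cases hχ0 : χ = 0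
    · subst hχ0
      have hvH := mem_rootSpace_zero.1 hv
      have h1 := hxy.sum_smul H.toSubmodule.subtype ⟨v, hvH⟩
      change ∑ i, B (x i) v • (y i : L) = v at h1
      rw [h1, Finset.sum_eq_zero fun α _ => by rw [heh α ⟨v, hvH⟩, zero_smul],
        Finset.sum_eq_zero fun α _ => by rw [hfh α ⟨v, hvH⟩, zero_smul], add_zero, add_zero]
    by_cases hbot : rootSpace H χ = ⊥
    · have : v = 0 := by simpa [hbot] using hv
      subst this
      simp
    have hx0 : ∑ i, B (x i) v • (y i : L) = 0 := Finset.sum_eq_zero fun i _ => by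
      rw [orth (χ := 0) (by rwa [zero_add]) (mem_rootSpace_zero.2 (x i).2) hv, zero_smul]
    rw [hx0, zero_add]
    obtain ⟨α, rfl⟩ := exists_dual_of_rootSpace_ne_bot hbot
    have hroot : IsRoot H α := ⟨fun h => hχ0 (by rw [h]; rfl), hbot⟩
    rcases hP.xor α hroot with hα | hα
    · obtain ⟨c, rfl⟩ := hespan ⟨α, hα.1⟩ v hv
      rw [Finset.sum_eq_zero fun β _ => by rw [map_smul, hee, smul_zero, zero_smul], zero_add,
        Finset.sum_eq_single ⟨α, hα.1⟩, map_smul, hs, hef, smul_eq_mul, mul_one]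
      · intro β _ hβ
        rw [map_smul, hs, hef0 _ _ hβ.symm, smul_zero, zero_smul]
      · simp
    · have hv' : v ∈ rootSpace H (-((-α : Module.Dual ℂ H)) : H → ℂ) := by
        have : -((-α : Module.Dual ℂ H) : H → ℂ) = α := by ext; simp
        rwa [this]
      obtain ⟨c, rfl⟩ := hfspan ⟨-α, hα.1⟩ v hv'
      rw [Finset.sum_eq_single ⟨-α, hα.1⟩, map_smul, hef, smul_eq_mul, mul_one,
        Finset.sum_eq_zero fun β _ => by rw [map_smul, hff, smul_zero, zero_smul], add_zero]
      · intro β _ hβ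
        rw [map_smul, hef0 _ _ hβ, smul_zero, zero_smul]
      · simp
  -- The highest weight vector.
  obtain ⟨v, hv0, hev⟩ : ∃ v : Cl B, v ≠ 0 ∧ ∀ α, gamma B (e α) * v = 0 := by
    refine ⟨((Finset.univ : Finset P).toList.map fun α => gamma B (e α)).prod,
      prod_gamma_ne_zero (fun α => B (f α)) (fun α => ?_) (fun α β h => ?_)
      (Finset.nodup_toList _), fun α => gamma_mul_prod_eq_zero hs hee (by simp)⟩
    · rw [hs, hef]
    · rw [hs, hef0 _ _ h.symm]
  have hposv : ∀ α ∈ P, ∀ u ∈ rootSpace H α, gamma B u * v = 0 := by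
    intro α hα u hu
    obtain ⟨c, rfl⟩ := hespan ⟨α, hα⟩ u hu
    rw [map_smul, smul_mul_assoc, hev, smul_zero]
  have hswap : ∀ u u', gamma B u * v = 0 → gamma B u * gamma B u' * v = B u u' • v := by
    intro u u' h
    have h1 := gamma_mul_add hs u u'
    rw [Algebra.smul_def, ← h1, add_mul, mul_assoc (gamma B u'), h, mul_zero, add_zero]
  have hspin : ∀ u, 2 • (spin hB u * v) = ∑ i, gamma B ⁅u, (x i : L)⁆ * gamma B (y i : L) * v +
      ∑ α, gamma B ⁅u, e α⁆ * gamma B (f α) * v := by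
    intro u
    rw [← smul_mul_assoc, two_nsmul_spin hB hd' u]
    simp only [Fintype.sum_sum_type, z', w', Sum.elim_inl, Sum.elim_inr, add_mul, Finset.sum_mul]
    rw [Finset.sum_eq_zero (f := fun α => gamma B ⁅u, f α⁆ * gamma B (e α) * v)
      fun α _ => by rw [mul_assoc, hev, mul_zero], add_zero]
  have hspin_e : ∀ δ, spin hB (e δ) * v = 0 := by
    intro δ
    apply nsmul_cancel (S := ℂ) 2 two_ne_zero
    rw [hspin, smul_zero, Finset.sum_eq_zero, Finset.sum_eq_zero, add_zero]
    · intro α _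
      have hmem : ⁅e δ, e α⁆ ∈ rootSpace H
          (((δ : Module.Dual ℂ H) : H → ℂ) + (α : Module.Dual ℂ H)) :=
        lie_mem_genWeightSpace_of_mem_genWeightSpace (he δ) (he α)
      rw [hswap, orth _ hmem (hf α), zero_smul]
      · rw [add_neg_cancel_right]
        exact hne0 δ
      · by_cases hbot : rootSpace H (((δ : Module.Dual ℂ H) : H → ℂ) + (α : Module.Dual ℂ H)) = ⊥
        · have : ⁅e δ, e α⁆ = 0 := by
            rw [hbot] at hmem
            simpa using hmem
          rw [this, map_zero, zero_mul]
        · exact hposv _ (hP.closed _ δ.2 _ α.2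
            ⟨fun h => hne δ α (funext fun u => LinearMap.congr_fun h u), hbot⟩) _ hmem
    · intro i _
      have hmem := lie_mem_genWeightSpace_of_mem_genWeightSpace (he δ)
        (mem_rootSpace_zero.2 (x i).2)
      rw [add_zero] at hmem
      rw [hswap _ _ (hposv _ δ.2 _ hmem), orth _ hmem (mem_rootSpace_zero.2 (y i).2), zero_smul]
      rw [add_zero]
      exact hne0 δ
  have hspin_h : ∀ h : H, spin hB (h : L) * v = halfSum P h • v := by
    intro h
    apply nsmul_cancel (S := ℂ) 2 two_ne_zero
    rw [hspin, Finset.sum_eq_zero, zero_add]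
    · have h1 : ∀ α : P, gamma B ⁅(h : L), e α⁆ * gamma B (f α) * v =
          (α : Module.Dual ℂ H) h • v := by
        intro α
        rw [hhe, map_smul, smul_mul_assoc, smul_mul_assoc, hswap _ _ (hev α), hef, one_smul]
      simp only [h1, ← Finset.sum_smul]
      rw [Finset.sum_coe_sort P fun α : Module.Dual ℂ H => α h, ← Nat.cast_smul_eq_nsmul ℂ, smul_smul,
        halfSum]
      simp
    · intro i _
      rw [cartan_lie_eq_zero hM h (x i), map_zero, zero_mul, zero_mul]
  -- The vector that represents `ρ`.
  set ρ := halfSum P with hρ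
  let tρ : H := (BH.toDual hH).symm ρ
  have htρ : ∀ h, BH tρ h = ρ h := fun h => by
    have : BH.toDual hH tρ = ρ := LinearEquiv.apply_symm_apply _ _
    rw [← this]
    rfl
  have hρρ : dualNormSq _ hH ρ = ρ tρ := rfl
  have hef_mem : ∀ α, ⁅e α, f α⁆ ∈ H := fun α => by
    have := lie_mem_genWeightSpace_of_mem_genWeightSpace (he α) (hf α)
    rw [add_neg_cancel] at this
    exact mem_rootSpace_zero.1 this
  have hρt : ∀ α : P, ρ ⟨_, hef_mem α⟩ = (α : Module.Dual ℂ H) tρ := by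
    intro α
    rw [← htρ]
    change B (tρ : L) ⁅e α, f α⁆ = _
    rw [← hi, hhe, map_smul, LinearMap.smul_apply, hef, smul_eq_mul, mul_one]
  have hcas : (∑ i, spin hB (z' i) * spin hB (w' i)) * v = (3 * ρ tρ) • v := by
    simp only [Fintype.sum_sum_type, z', w', Sum.elim_inl, Sum.elim_inr, add_mul, Finset.sum_mul]
    rw [Finset.sum_eq_zero (f := fun α => spin hB (f α) * spin hB (e α) * v)
      fun α _ => by rw [mul_assoc, hspin_e, mul_zero], add_zero]
    have h1 : ∀ i, spin hB (x i : L) * spin hB (y i : L) * v = (BH tρ (x i) • ρ (y i)) • v := by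
      intro i
      rw [mul_assoc, hspin_h, mul_smul_comm, hspin_h, smul_smul, htρ, smul_eq_mul, mul_comm]
    have h2 : ∀ α, spin hB (e α) * spin hB (f α) * v = (α : Module.Dual ℂ H) tρ • v := by
      intro α
      have h3 := spin_lie hB hs hi (e α) (f α)
      have h4 := hspin_h ⟨_, hef_mem α⟩
      rw [hρt] at h4
      rw [← h4, h3, sub_mul, mul_assoc (spin hB (f α)), hspin_e, mul_zero, sub_zero]
    simp only [h1, h2, ← Finset.sum_smul]
    rw [hxy.sum_smul' ρ, ← add_smul]
    congr 1
    have h5 : ρ tρ = (1 / 2) * ∑ α : P, (α : Module.Dual ℂ H) tρ := by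
      rw [Finset.sum_coe_sort P fun α : Module.Dual ℂ H => α tρ]
      simp [hρ, halfSum]
    linear_combination (-2) * h5
  have h8 := sum_spin_mul_spin hB hs hi hd
  rw [sum_spin_mul_spin_congr hB hd hd'] at h8
  have h9 := congrArg (· * v) h8
  simp only [smul_mul_assoc, hcas] at h9
  rw [← Algebra.smul_def, ← Nat.cast_smul_eq_nsmul ℂ, smul_smul] at h9
  have h10 := smul_left_injective ℂ hv0 h9
  rw [hρρ, ← h10]
  push_cast
  ring

end StrangeFormula

/-! ### Reductive Lie algebras and the square of the Dirac operator -/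

section Reductive

open LieAlgebra LieModule

variable {L : Type*} [LieRing L] [LieAlgebra ℂ L] [FiniteDimensional ℂ L]
  [HasCentralRadical ℂ L]

lemma mem_center_of_killingForm_eq_zero {x : L} (hx : ∀ y, killingForm ℂ L x y = 0) :
    x ∈ center ℂ L := by
  rw [← HasCentralRadical.radical_eq_center (R := ℂ) (L := L)]
  apply killingCompl_top_le_radical ℂ L
  rw [LieIdeal.mem_killingCompl]
  intro y _
  rw [LieModule.traceForm_comm]
  exact hx y

/-- The second centre of a reductive Lie algebra is its centre, being a solvable ideal. -/
lemma mem_center_of_lie_mem_center {x : L} (hx : ∀ y : L, ⁅y, x⁆ ∈ center ℂ L) : x ∈ center ℂ L := by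
  let I : LieIdeal ℂ L := (center ℂ L).normalizer
  have h1 : ⁅I, I⁆ ≤ center ℂ L :=
    (LieSubmodule.lie_le_iff _ _ _).2 fun u _ v hv => hv u
  have h2 : ⁅⁅I, I⁆, ⁅I, I⁆⁆ = ⊥ := by
    rw [LieSubmodule.lie_eq_bot_iff]
    intro u _ v hv
    exact (mem_maxTrivSubmodule ℂ L L v).1 (h1 hv) u
  have : IsSolvable I :=
    IsSolvable.mk (R := ℂ) (k := 2) ((LieIdeal.derivedSeries_eq_bot_iff I 2).2 h2)
  rw [← HasCentralRadical.radical_eq_center (R := ℂ) (L := L)]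
  exact (LieIdeal.solvable_iff_le_radical ℂ L I).1 this hx

/-- In a reductive Lie algebra with a nondegenerate invariant form `B`, the Killing form is
nondegenerate on the derived algebra. If `κ(x, y) = B(S x, y)`, then the kernel of `S` is the
centre and equals the kernel of `S²`, and the derived algebra is contained in the image of `S`. -/
lemma separatesDerived_self {B : BilinForm ℂ L} (hs : ∀ x y, B x y = B y x)
    (hi : ∀ x y z, B ⁅x, y⁆ z = B x ⁅y, z⁆) (hn : B.Nondegenerate) : SeparatesDerived L L := by
  let S : L →ₗ[ℂ] L := (B.toDual hn).symm.toLinearMap ∘ₗ killingForm ℂ L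
  have hS : ∀ x y, B (S x) y = killingForm ℂ L x y := fun x y => by
    have : B.toDual hn (S x) = killingForm ℂ L x := LinearEquiv.apply_symm_apply _ _
    rw [← this]
    rfl
  have hB0 : ∀ x, (∀ y, B x y = 0) → x = 0 := hn.1
  have hSs : ∀ x y, B (S x) y = B x (S y) := fun x y => by
    rw [hS, traceForm_comm, ← hS, hs]
  have hSlie : ∀ x y, S ⁅x, y⁆ = ⁅x, S y⁆ := fun x y => by
    rw [← sub_eq_zero]
    refine hB0 _ fun z => ?_
    rw [map_sub, LinearMap.sub_apply, hS, form_lie_skew hi, hS, ← lie_skew, map_neg,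
      LinearMap.neg_apply, traceForm_apply_lie_apply, sub_self]
  have hSc : ∀ x, S x = 0 → x ∈ center ℂ L := fun x hx =>
    mem_center_of_killingForm_eq_zero fun y => by rw [← hS, hx]; simp
  have hcS : ∀ x ∈ center ℂ L, S x = 0 := fun x hx => by
    refine hB0 _ fun z => ?_
    have had : ad ℂ L x = 0 := by
      ext y
      rw [ad_apply, ← lie_skew, (mem_maxTrivSubmodule ℂ L L x).1 hx y, neg_zero]
      rfl
    rw [hS, killingForm_apply_apply, had, LinearMap.zero_comp, map_zero]
  have hder : ∀ z ∈ (⁅(⊤ : LieIdeal ℂ L), (⊤ : LieIdeal ℂ L)⁆ : LieIdeal ℂ L),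
      ∀ w ∈ LinearMap.ker S, B z w = 0 := by
    intro z hz w hw
    rw [← LieSubmodule.mem_toSubmodule, LieSubmodule.lieIdeal_oper_eq_linear_span'] at hz
    induction hz using Submodule.span_induction with
    | mem z hz =>
      obtain ⟨x, -, y, -, rfl⟩ := hz
      rw [hi, (mem_maxTrivSubmodule ℂ L L w).1 (hSc w hw) y, map_zero]
    | zero => simp
    | add a b _ _ ha hb => rw [map_add, LinearMap.add_apply, ha, hb, add_zero]
    | smul c a _ ha => rw [map_smul, LinearMap.smul_apply, ha, smul_zero]
  intro z hz hz0
  obtain ⟨u, rfl⟩ : ∃ u, S u = z := by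
    have h2 : B z ∈ (LinearMap.ker S).dualAnnihilator := 
      (Submodule.mem_dualAnnihilator _).2 (hder z hz)
    rw [← LinearMap.range_dualMap_eq_dualAnnihilator_ker] at h2
    obtain ⟨φ, hφ⟩ := h2
    refine ⟨(B.toDual hn).symm φ, ?_⟩
    rw [← sub_eq_zero]
    refine hB0 _ fun v => ?_
    have h3 : B ((B.toDual hn).symm φ) = φ := LinearEquiv.apply_symm_apply (B.toDual hn) φ
    rw [map_sub, LinearMap.sub_apply, hSs, h3, ← hφ]
    simp
  have h4 := mem_center_of_killingForm_eq_zero hz0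
  apply hcS
  refine mem_center_of_lie_mem_center fun y => hSc _ ?_
  rw [hSlie]
  exact (mem_maxTrivSubmodule ℂ L L _).1 h4 y

end Reductive

namespace QuadraticPair

open LieAlgebra LieModule

variable {𝔤 : Type*} [LieRing 𝔤] [LieAlgebra ℂ 𝔤] [FiniteDimensional ℂ 𝔤]
  [HasCentralRadical ℂ 𝔤]

lemma separatesDerived (X : QuadraticPair 𝔤) : SeparatesDerived 𝔤 𝔤 :=
  separatesDerived_self X.β_symm X.β_lie X.β_nondegenerate

omit [FiniteDimensional ℂ 𝔤] [HasCentralRadical ℂ 𝔤] in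
lemma killingForm_θ (X : QuadraticPair 𝔤) (x y : 𝔤) : killingForm ℂ 𝔤 (X.θ x) (X.θ y) = killingForm ℂ 𝔤 x y :=
  killingForm_of_equiv_apply
    { X.θ with invFun := X.θ, left_inv := X.θ_θ, right_inv := X.θ_θ : 𝔤 ≃ₗ⁅ℂ⁆ 𝔤 } x y

/-- The trace form of `𝔨` on `𝔤` is nondegenerate on `[𝔨, 𝔨]`, since `𝔨` and `𝔭` are orthogonal for
the Killing form of `𝔤`. -/
lemma separatesDerived_k (X : QuadraticPair 𝔤) : SeparatesDerived X.k 𝔤 := by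
  intro x hx hx0
  apply Subtype.ext
  apply X.separatesDerived
  · clear hx0
    rw [← LieSubmodule.mem_toSubmodule, LieSubmodule.lieIdeal_oper_eq_linear_span'] at hx
    induction hx using Submodule.span_induction with
    | mem z hz =>
      obtain ⟨u, -, v, -, rfl⟩ := hz
      exact LieSubmodule.lie_mem_lie trivial trivial
    | zero => exact zero_mem _
    | add a b _ _ ha hb => exact add_mem ha hb
    | smul c a _ ha => exact Submodule.smul_mem _ c ha
  · intro y
    change killingForm ℂ 𝔤 x y = 0
    have h1 : killingForm ℂ 𝔤 x (X.proj 1 y) = 0 := hx0 ⟨_, X.proj_mem_k y⟩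
    have h2 : killingForm ℂ 𝔤 x (X.proj (-1) y) = 0 := by
      have h3 := X.killingForm_θ x (X.proj (-1) y)
      rw [X.mem_k.1 x.2, X.mem_p.1 (X.proj_mem_p y), map_neg] at h3
      linear_combination (-1 / 2 : ℂ) * h3
    rw [← X.proj_add_proj y, map_add, h1, h2, add_zero]

end QuadraticPair

end DiracFamily

end

open DiracFamily
theorem mainTheorem3 {𝔤 : Type*} [LieRing 𝔤] [LieAlgebra ℂ 𝔤] [FiniteDimensional ℂ 𝔤]
    [LieAlgebra.HasCentralRadical ℂ 𝔤] (X : QuadraticPair 𝔤)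
    {R : Type*} [CommRing R] [IsDomain R] [IsPrincipalIdealRing R] [Algebra ℂ R]
    {r : R} (hr : r ≠ 0)
    (h : LieSubalgebra ℂ 𝔤) [h.IsCartanSubalgebra]
    (P : Finset (Module.Dual ℂ h)) (hP : IsPositiveSystem h P)
    (t : LieSubalgebra ℂ X.k) [t.IsCartanSubalgebra]
    (Pk : Finset (Module.Dual ℂ t)) (hPk : IsPositiveSystem t Pk) :
    X.toConstant r (X.Ω hr) = (r ^ 2) ⊗ₜ[ℂ] X.Ωg ∧
    ∃ (hh : (pullForm X.β h.toSubmodule.subtype).Nondegenerate)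
      (ht : (pullForm (pullForm X.β X.k.toSubmodule.subtype) t.toSubmodule.subtype).Nondegenerate),
      (2 : R) • X.D hr ^ 2 =
        X.Ω hr ⊗ₜ[R] (1 : Cl (X.βr hr)) - r ^ 2 • X.ΔU hr (X.Ωk R) +
          (r ^ 2 * algebraMap ℂ R (dualNormSq _ hh (halfSum P) - dualNormSq _ ht (halfSum Pk))) •
            (1 : X.A hr) := by
  have hkn : X.formK.Nondegenerate :=
    LinearMap.BilinForm.nondegenerate_iff_ker_eq_bot.2 (LinearMap.ker_eq_bot.2 X.formK_unimodular.injective)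
  have hki : ∀ x y z : X.k, X.formK ⁅x, y⁆ z = X.formK x ⁅y, z⁆ := fun x y z => X.β_lie x y z
  obtain ⟨n, x, y, hk⟩ := exists_isDualFamily X.formK_symm X.formK_unimodular
  obtain ⟨m, a, b, hp⟩ := exists_isDualFamily X.formP_symm X.formP_unimodular
  have hh := nondegenerate_cartan (H := h) X.β_lie X.β_symm X.β_nondegenerate
  have ht := nondegenerate_cartan (H := t) hki X.formK_symm hkn
  refine ⟨X.toConstant_Ω hr, hh, ht, ?_⟩
  have h1 := casimirTrace_eq X.separatesDerived X.β_symm X.β_lie X.β_nondegenerate hP hh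
    (X.isDualFamily_sum hk hp)
  have h2 := casimirTrace_eq X.separatesDerived_k X.formK_symm hki hkn hPk ht hk
  rw [X.casimirTrace_sum hk hp, h2] at h1
  have h3 : dualNormSq _ hh (halfSum P) - dualNormSq _ ht (halfSum Pk) =
      1 / 8 * X.casimirTraceP x y a b := by
    linear_combination (-1 / 24 : ℂ) * h1
  rw [h3]
  exact X.two_smul_D_sq hr hk hp
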